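/- Call a finite graph $\Gamma$ *separating* if $\omega(\Gamma)\,\alpha(\Gamma)<|V(\Gamma)|$, where $\omega(\Gamma)$ and $\alpha(\Gamma)$ are the largest sizes of a clique and of a coclique of $\Gamma$. (i) For every prime power $q=p^m$ (with $m\ge 1$), the alternating forms graph $\mathrm{Alt}(5,q)$ is separating. Its vertices are the alternating bilinear forms on $\mathbb{F}_q^5$, two forms being adjacent when their difference has rank $2$. (ii) For every prime power $q$, the affine half-spin graph $\mathrm{VD}_{5,5}(q)$ is separating. Its vertices are the vectors of the $16$-dimensional half-spin module over $\mathbb{F}_q$ of the $10$-dimensional hyperbolic quadratic space, two vectors being adjacent when their difference is a (nonzero) pure spinor, that is, when the line joining them meets the hyperplane at infinity in a point of the half-spin geometry $D_{5,5}(q)$. (iii) For every integer $e\ge 0$, with $q=2^{2e+1}$, the graph $\mathrm{VSz}(q)$ is separating. Its vertices are the vectors of $\mathbb{F}_q^4$, two being adjacent when the line joining them meets the hyperplane at infinity $\mathrm{PG}(3,q)$ in a point of the Suzuki–Tits ovoid $$\{\langle(0,0,0,1)\rangle\}\cup\{\langle(1,x,y,\,xy+x^{\sigma+2}+y^{\sigma})\rangle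 : x,y\in\mathbb{F}_q\},\qquad t^{\sigma}=t^{2^{e+1}}.$$ -/

import Mathlib

/-- A graph is separating if the product of its clique number and its coclique number is strictly
smaller than its number of vertices (which is then necessarily finite and nonzero). -/
def SeparatingGraph {V : Type*} (G : SimpleGraph V) : Prop :=
  G.cliqueNum * G.indepNum < Nat.card V

section AlternatingForms

/-- The alternating bilinear forms on `F ^ n`, given by their Gram matrices: the skew-symmetric
`n × n` matrices with zero diagonal. -/
abbrev AltMatrix (n : ℕ) (F : Type*) [Field F] : Type _ :=
  {A : Matrix (Fin n) (Fin n) F // A.transpose = -A ∧ ∀ i, A i i = 0}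

/-- The alternating forms graph `Alt(n, q)` over the field `F` with `q` elements: two alternating
forms are adjacent when their difference has rank `2`. -/
def altFormsGraph (n : ℕ) (F : Type*) [Field F] : SimpleGraph (AltMatrix n F) where
  Adj A B := (A.1 - B.1).rank = 2
  symm := ⟨fun A B h => by
    rw [← neg_sub, ← neg_one_smul F,
      Matrix.rank_smul_of_mem_nonZeroDivisors _ (mem_nonZeroDivisors_of_ne_zero (by simp))]
    exact h⟩
  loopless := ⟨fun A h => by simp at h⟩

end AlternatingForms

section HalfSpin

/-- The spin representation of the hyperbolic quadratic space `W × Dual W`, with quadratic form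
`(w, f) ↦ f w`, on the exterior algebra of `W`: a vector `w` acts by exterior multiplication
and a functional `f` by contraction. -/
noncomputable def spinAction (F W : Type*) [Field F] [AddCommGroup W] [Module F W] :
    W × Module.Dual F W →ₗ[F] ExteriorAlgebra F W →ₗ[F] ExteriorAlgebra F W :=
  ((LinearMap.mul F (ExteriorAlgebra F W)).comp (ExteriorAlgebra.ι F)).coprod
    CliffordAlgebra.contractLeft

/-- The vectors of the quadratic space `W × Dual W` that annihilate the spinor `ψ`. For `ψ ≠ 0` they
form a totally singular subspace. -/
noncomputable def spinorAnnihilator {F W : Type*} [Field F] [AddCommGroup W] [Module F W]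
    (ψ : ExteriorAlgebra F W) : Submodule F (W × Module.Dual F W) :=
  LinearMap.ker ((spinAction F W).flip ψ)

/-- A spinor is pure if it is nonzero and is annihilated by a maximal totally singular subspace,
that is, one of dimension `dim W`. -/
def IsPureSpinor {F W : Type*} [Field F] [AddCommGroup W] [Module F W]
    (ψ : ExteriorAlgebra F W) : Prop :=
  ψ ≠ 0 ∧ Module.finrank F (spinorAnnihilator ψ) = Module.finrank F W

/-- The half-spin module of the `2n`-dimensional hyperbolic space: the even part of the exterior
algebra of `F ^ n`. It has dimension `2 ^ (n - 1)` (so `16` for `n = 5`). -/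
abbrev HalfSpinModule (n : ℕ) (F : Type*) [Field F] : Submodule F (ExteriorAlgebra F (Fin n → F)) :=
  CliffordAlgebra.evenOdd (0 : QuadraticForm F (Fin n → F)) 0

/-- The affine half-spin graph `VD_{5,5}(q)` over the field `F` with `q` elements. Its vertices are
the vectors of the `16`-dimensional half-spin module, two being adjacent when the line joining them
meets the hyperplane at infinity in a point of the half-spin geometry `D_{5,5}(q)`, whose points are
those spanned by the pure spinors in the half-spin module. -/
def affineHalfSpinGraph (F : Type*) [Field F] : SimpleGraph (HalfSpinModule 5 F) where
  Adj u v := IsPureSpinor ((u - v : HalfSpinModule 5 F) : ExteriorAlgebra F (Fin 5 → F))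
  symm := ⟨fun u v h => by
    have hneg : spinorAnnihilator
        ((v - u : HalfSpinModule 5 F) : ExteriorAlgebra F (Fin 5 → F)) =
        spinorAnnihilator ((u - v : HalfSpinModule 5 F) : ExteriorAlgebra F (Fin 5 → F)) := by
      rw [← neg_sub u v, Submodule.coe_neg]
      ext x
      simp only [spinorAnnihilator, LinearMap.mem_ker, map_neg, LinearMap.neg_apply, neg_eq_zero]
    refine ⟨?_, by rw [hneg]; exact h.2⟩
    intro h0
    apply h.1
    rw [← neg_sub v u, Submodule.coe_neg, h0, neg_zero]⟩
  loopless := ⟨fun u h => h.1 (by simp)⟩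

end HalfSpin

section SuzukiTits

/-- The nonzero vectors that span a point of the Suzuki–Tits ovoid of `PG(3, q)`, where `F` is the
field with `q = 2 ^ (2e + 1)` elements. With `σ : t ↦ t ^ (2 ^ (e + 1))`, so that `σ² : t ↦ t ^ 2`,
the ovoid consists of `⟨(0, 0, 0, 1)⟩` and all `⟨(1, x, y, x y + x ^ (σ + 2) + y ^ σ)⟩`. -/
def suzukiTitsCone (e : ℕ) (F : Type*) [Field F] : Set (Fin 4 → F) :=
  {v | ∃ c : F, c ≠ 0 ∧ (v = c • ![0, 0, 0, 1] ∨
    ∃ x y : F, v = c • ![1, x, y, x * y + x ^ (2 ^ (e + 1) + 2) + y ^ (2 ^ (e + 1))])}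

/-- The graph `VSz(q)`, where `F` is the field with `q = 2 ^ (2e + 1)` elements: the vertices are the
vectors of `F ^ 4`, two being adjacent when the line joining them meets the hyperplane at infinity
`PG(3, q)` in a point of the Suzuki–Tits ovoid. -/
def suzukiGraph (e : ℕ) (F : Type*) [Field F] : SimpleGraph (Fin 4 → F) where
  Adj u v := u - v ∈ suzukiTitsCone e F
  symm := ⟨fun u v h => by
    obtain ⟨c, hc, h⟩ := h
    refine ⟨-c, neg_ne_zero.mpr hc, ?_⟩
    rw [← neg_sub u v]
    rcases h with h | ⟨x, y, h⟩
    · exact Or.inl (by rw [h, neg_smul])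
    · exact Or.inr ⟨x, y, by rw [h, neg_smul]⟩⟩
  loopless := ⟨fun u h => by
    obtain ⟨c, hc, h⟩ := h
    rw [sub_self] at h
    rcases h with h | ⟨x, y, h⟩
    · have := congrFun h 3
      simp at this
      exact hc this.symm
    · have := congrFun h 0
      simp at this
      exact hc this.symm⟩

end SuzukiTits

/-! All three graphs are translation graphs on a finite vector space `W`, and one criterion,
`separatingGraph_of_clique_subspaces`, serves for all. Suppose cliques have at most `N > 1`
vertices, and every nonzero functional vanishes on some subspace `U` of size `N` that is a clique.
For a coclique `Y` all sums `y + u` are distinct, so `|Y| * N ≤ |W|`. Under equality `W = Y + U` for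
every such `U`, so each nonzero functional takes all its values equally often on `Y`. This forces `Y
= W`, by a counting form of the Fourier argument, contradicting `N > 1`.

For the Suzuki graph `N = q`: no three points of the ovoid are collinear, so cliques lie on lines,
and every plane meets the ovoid.

For `Alt(5, q)`, `N = q ^ 4`. Rank at most `2` means that all 4-point Pfaffians vanish. These are
quadratic forms, so after translation to contain `0` the span of a clique still has rank at most
`2`, hence dimension at most `4`. Given `φ`, the form `(a, w) ↦ φ (a ∧ w)` is alternating in odd
dimension, so has some `a ≠ 0` in its radical, and `U = a ∧ F ^ 5` works.

For the half-spin graph `N = q ^ 5`. Pure spinors satisfy quadratic relations (scalar part times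
quartic part is a Pfaffian of the quadratic part). Once a clique contains `0` and a spinor `u` with
nonzero scalar part, projection from `u` reduces the bound to the alternating forms one, with a
factor `q` for the scalar part. The subspaces are images of `F + a ∧ W` under purity-preserving
operators, with `a` again taken from a radical. -/

/-! ### The separation criterion. -/

/-- The level sets of a nonzero functional on a finite vector space all have the same size. -/
theorem card_mul_card_level {F W : Type*} [Field F] [Finite F] [AddCommGroup W] [Module F W]
    [Finite W] (φ : W →ₗ[F] F) (hφ : φ ≠ 0) (c : F) :
    Nat.card F * Nat.card {x // φ x = c} = Nat.card W := by
  have hs : Function.Surjective φ := LinearMap.surjective hφ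
  obtain ⟨x₀, hx₀⟩ := hs c
  have h1 : Nat.card {x // φ x = c} = Nat.card (LinearMap.ker φ) := by
    refine Nat.card_congr ⟨fun x => ⟨x.1 - x₀, ?_⟩, fun y => ⟨y.1 + x₀, ?_⟩, ?_, ?_⟩
    · simp [x.2, hx₀]
    · have := y.2
      simp only [LinearMap.mem_ker] at this
      simp [this, hx₀]
    · intro x; simp
    · intro x; simp
  rw [h1, Submodule.card_eq_card_quotient_mul_card (LinearMap.ker φ),
    Nat.card_congr (φ.quotKerEquivOfSurjective hs).toEquiv, mul_comm]

open Classical in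
/-- A nonempty subset of a finite vector space that meets the level sets of each nonzero functional
equally often is everything. -/
theorem eq_univ_of_equidistributed {F W : Type*} [Field F] [Finite F] [AddCommGroup W] [Module F W]
    [Finite W] (Y : Finset W) (hY : Y.Nonempty)
    (h : ∀ φ : Module.Dual F W, φ ≠ 0 → ∀ c : F,
      Nat.card F * (Y.filter fun y => φ y = c).card = Y.card) (w : W) : w ∈ Y := by
  by_contra hw
  have : Finite (Module.Dual F W) := Module.finite_of_finite F
  have := Fintype.ofFinite (Module.Dual F W)
  set q := Nat.card F
  set M := Nat.card (Module.Dual F W)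
  -- Double count the pairs `(φ, y)` with `φ y = φ w`, scaled by `q`. The zero functional gives `q *
  -- |Y|` and each other one `|Y|`, whereas each `y ≠ w` gives `M`. The two totals differ by `(q -
  -- 1) * |Y|`.
  have hq : 1 < q := Finite.one_lt_card
  have key : ∑ φ : Module.Dual F W, (Y.filter fun y => φ y = φ w).card =
      ∑ y ∈ Y, (Finset.univ.filter fun φ : Module.Dual F W => φ y = φ w).card := by
    simp only [Finset.card_filter]
    rw [Finset.sum_comm]
  have hl : q * ∑ φ : Module.Dual F W, (Y.filter fun y => φ y = φ w).card =
      q * Y.card + (M - 1) * Y.card := by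
    rw [← Finset.add_sum_erase _ _ (Finset.mem_univ (0 : Module.Dual F W)), mul_add]
    congr 1
    · simp
    · rw [Finset.mul_sum, Finset.sum_congr rfl fun φ hφ => h φ (Finset.ne_of_mem_erase hφ) _]
      simp [M, Nat.card_eq_fintype_card, Finset.card_erase_of_mem]
  have hr : q * ∑ y ∈ Y, (Finset.univ.filter fun φ : Module.Dual F W => φ y = φ w).card =
      Y.card * M := by
    rw [Finset.mul_sum, Finset.sum_const_nat (m := M)]
    intro y hy
    have hyw : y - w ≠ 0 := sub_ne_zero.mpr fun e => hw (e ▸ hy)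
    have hne : Module.Dual.eval F W (y - w) ≠ 0 := by
      rwa [Ne, Module.eval_apply_eq_zero_iff]
    have := card_mul_card_level (Module.Dual.eval F W (y - w)) hne 0
    refine Eq.trans ?_ this
    congr 1
    rw [← Fintype.card_subtype, Nat.card_eq_fintype_card]
    refine Fintype.card_congr (Equiv.subtypeEquivRight fun φ => ?_)
    simp [sub_eq_zero]
  rw [key, hr] at hl
  have hM : 1 ≤ M := Nat.card_pos
  have hYc := hY.card_pos
  obtain ⟨m, hm⟩ := Nat.exists_eq_add_of_le hM
  rw [hm, Nat.add_sub_cancel_left] at hl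
  nlinarith

/-- A graph on a finite vector space `W` (up to relabelling the vertices) whose adjacency depends on
the difference only is separating as soon as its cliques have size at most `N` and each
nonzero functional on `W` vanishes on a clique of size `N` that is a subspace. -/
theorem separatingGraph_of_clique_subspaces {F V W : Type*} [Field F] [Finite F] [AddCommGroup W]
    [Module F W] [Finite W] [Nontrivial W] (G : SimpleGraph V) (e : V ≃ W) (D : Set W)
    (hG : ∀ u v, G.Adj u v ↔ e u - e v ∈ D) (N : ℕ) (hN : 1 < N)
    (hcl : ∀ s : Finset V, G.IsClique s → s.card ≤ N)
    (hU : ∀ φ : Module.Dual F W, φ ≠ 0 → ∃ U : Submodule F W, Nat.card U = N ∧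
      (∀ x ∈ U, x ≠ 0 → x ∈ D) ∧ ∀ x ∈ U, φ x = 0) : SeparatingGraph G := by
  classical
  obtain ⟨C, hC⟩ := G.exists_isNClique_cliqueNum
  obtain ⟨Y₀, hY₀⟩ := G.exists_isNIndepSet_indepNum
  have hω : G.cliqueNum ≤ N := hC.card_eq ▸ hcl C hC.isClique
  set Y : Finset W := Y₀.map e.toEmbedding with hYdef
  have hYcard : Y.card = G.indepNum := by rw [hYdef, Finset.card_map, hY₀.card_eq]
  have hY : ∀ x ∈ Y, ∀ y ∈ Y, x - y ∈ D → x = y := by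
    intro x hx y hy hxy
    obtain ⟨u, hu, rfl⟩ := Finset.mem_map.mp hx
    obtain ⟨v, hv, rfl⟩ := Finset.mem_map.mp hy
    by_contra hne
    exact hY₀.isIndepSet hu hv (fun h => hne (by rw [h])) ((hG u v).mpr hxy)
  -- Two representations of the same sum give a difference of members of `Y` lying in `U`, hence in
  -- `D` unless it is zero.
  have hinj : ∀ U : Submodule F W, (∀ x ∈ U, x ≠ 0 → x ∈ D) →
      Function.Injective fun p : Y × U => (p.1 : W) + (p.2 : W) := by
    rintro U hUD ⟨⟨y, hy⟩, ⟨u, hu⟩⟩ ⟨⟨y', hy'⟩, ⟨u', hu'⟩⟩ heq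
    simp only at heq
    have hd : y - y' = u' - u := by
      rw [sub_eq_sub_iff_add_eq_add, heq, add_comm]
    have : y = y' := by
      by_contra hne
      exact hne (hY y hy y' hy' (hUD _ (hd ▸ U.sub_mem hu' hu) (sub_ne_zero.mpr hne)))
    subst this
    simpa using heq
  have hle : ∀ U : Submodule F W, (∀ x ∈ U, x ≠ 0 → x ∈ D) →
      Y.card * Nat.card U ≤ Nat.card W := by
    intro U hUD
    have := Nat.card_le_card_of_injective _ (hinj U hUD)
    rwa [Nat.card_prod, Nat.card_eq_fintype_card (α := Y), Fintype.card_coe] at this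
  have hV : Nat.card V = Nat.card W := Nat.card_congr e
  obtain ⟨φ₀, hφ₀⟩ := exists_ne (0 : Module.Dual F W)
  obtain ⟨U₀, hU₀N, hU₀D, -⟩ := hU φ₀ hφ₀
  have hbound : Y.card * N ≤ Nat.card W := hU₀N ▸ hle U₀ hU₀D
  rw [SeparatingGraph, hV, ← hYcard]
  refine lt_of_le_of_ne ((Nat.mul_le_mul_right _ hω).trans ?_) fun heq => ?_
  · rwa [mul_comm]
  have hcard : Y.card * N = Nat.card W := by
    refine le_antisymm hbound ?_
    rw [← heq, mul_comm]
    exact Nat.mul_le_mul_left _ hω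
  have hWpos : 0 < Nat.card W := Nat.card_pos
  have hYpos : 0 < Y.card := by
    rcases Nat.eq_zero_or_pos Y.card with h | h
    · rw [h, zero_mul] at hcard; omega
    · exact h
  -- Equality makes every clique subspace of size `N` a complement of `Y`: each vector is uniquely
  -- `y + u`.
  have huniv := eq_univ_of_equidistributed (F := F) Y (Finset.card_pos.mp hYpos) ?_
  · have h1 : Y = @Finset.univ W (Fintype.ofFinite W) := by
      ext w; simp [huniv w]
    have h2 : Y.card = Nat.card W := by
      have := Fintype.ofFinite W
      rw [Nat.card_eq_fintype_card, Finset.eq_univ_of_forall huniv, Finset.card_univ]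
    rw [h2] at hcard
    nlinarith
  intro φ hφ c
  obtain ⟨U, hUN, hUD, hUφ⟩ := hU φ hφ
  have hbij : Function.Bijective fun p : Y × U => (p.1 : W) + (p.2 : W) := by
    have := Fintype.ofFinite W
    have := Fintype.ofFinite U
    refine (Fintype.bijective_iff_injective_and_card _).mpr ⟨hinj U hUD, ?_⟩
    rw [Fintype.card_prod, Fintype.card_coe, ← Nat.card_eq_fintype_card,
      ← Nat.card_eq_fintype_card, hUN, hcard]
  -- Since `φ` vanishes on `U`, its level sets in `W` are those in `Y` translated by all of `U`.
  have hcount : Nat.card {x // φ x = c} = (Y.filter fun y => φ y = c).card * N := by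
    have e1 : {p : Y × U // φ ((p.1 : W) + (p.2 : W)) = c} ≃ {x // φ x = c} :=
      (Equiv.ofBijective _ hbij).subtypeEquiv fun p => Iff.rfl
    have e2 : {p : Y × U // φ ((p.1 : W) + (p.2 : W)) = c} ≃
        (Y.filter fun y => φ y = c : Finset W) × U :=
      { toFun := fun p => (⟨p.1.1, by
          have := p.2
          rw [map_add, hUφ _ p.1.2.2, add_zero] at this
          exact Finset.mem_filter.mpr ⟨p.1.1.2, this⟩⟩, p.1.2)
        invFun := fun p => ⟨(⟨p.1, (Finset.mem_filter.mp p.1.2).1⟩, p.2), by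
          rw [map_add, hUφ _ p.2.2, add_zero]
          exact (Finset.mem_filter.mp p.1.2).2⟩
        left_inv := fun p => rfl
        right_inv := fun p => rfl }
    rw [← Nat.card_congr e1, Nat.card_congr e2, Nat.card_prod, hUN,
      Nat.card_eq_fintype_card (α := (Y.filter fun y => φ y = c : Finset W)), Fintype.card_coe]
  have := card_mul_card_level φ hφ c
  rw [hcount, ← hcard, ← mul_assoc] at this
  exact Nat.eq_of_mul_eq_mul_right (by omega) this

/-! ### Degeneracy of alternating forms in dimension five. -/

/-- An alternating form in odd dimension `5` is degenerate. -/
theorem exists_ne_zero_of_alternating_five {F : Type*} [Field F]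
    (b : (Fin 5 → F) →ₗ[F] (Fin 5 → F) →ₗ[F] F) (hb : ∀ x, b x x = 0) :
    ∃ a, a ≠ 0 ∧ ∀ w, b a w = 0 := by
  have hanti : ∀ x y, b y x = -b x y := by
    intro x y
    have h := hb (x + y)
    simp only [map_add, LinearMap.add_apply, hb] at h
    linear_combination h
  set B : Matrix (Fin 5) (Fin 5) F := Matrix.of fun i j => b (Pi.single i 1) (Pi.single j 1)
  have hd : ∀ i, B i i = 0 := fun i => hb _
  have hs : ∀ i j, B j i = -B i j := fun i j => hanti _ _
  -- Expanding the generic alternating determinant shows that it vanishes in characteristic `2` as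
  -- well, where skew-symmetry alone would not suffice.
  have hdet : B.det = 0 := by
    have hB : B = !![0, B 0 1, B 0 2, B 0 3, B 0 4; -B 0 1, 0, B 1 2, B 1 3, B 1 4;
        -B 0 2, -B 1 2, 0, B 2 3, B 2 4; -B 0 3, -B 1 3, -B 2 3, 0, B 3 4;
        -B 0 4, -B 1 4, -B 2 4, -B 3 4, 0] := by
      ext i j
      fin_cases i <;> fin_cases j <;> first | exact hd _ | exact hs _ _ | rfl
    rw [hB]
    generalize B 0 1 = x01, B 0 2 = x02, B 0 3 = x03, B 0 4 = x04, B 1 2 = x12, B 1 3 = x13,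
      B 1 4 = x14, B 2 3 = x23, B 2 4 = x24, B 3 4 = x34
    simp [Matrix.det_succ_row_zero, Fin.sum_univ_succ, Fin.succAbove]
    ring
  obtain ⟨a, ha, haB⟩ := Matrix.exists_vecMul_eq_zero_iff.mpr hdet
  refine ⟨a, ha, fun w => ?_⟩
  have h0 : ∀ j, b a (Pi.single j 1) = 0 := by
    intro j
    have := congrFun haB j
    rw [Matrix.vecMul, dotProduct] at this
    simp only [Pi.zero_apply] at this
    have ha' : a = ∑ i, a i • (Pi.single i 1 : Fin 5 → F) := by
      ext k; simp [Finset.sum_apply, Pi.single_apply]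
    conv_lhs => rw [ha', map_sum, LinearMap.sum_apply]
    rw [← this]
    exact Finset.sum_congr rfl fun i _ => by simp [B]
  have : b a = 0 := by
    refine LinearMap.pi_ext' fun j => ?_
    ext
    simpa using h0 j
  rw [this]; rfl

/-! ### The Suzuki–Tits ovoid and its affine graph. -/

/-- The identity behind the inversion `(1, x, y, z) ↦ (z, y, x, 1)` of the Suzuki–Tits ovoid, for an
endomorphism `T` whose square is the Frobenius. -/
theorem suzukiTits_inversion {F : Type*} [Field F] [CharP F 2] (T : F →+* F)
    (hT : ∀ t, T (T t) = t ^ 2) (x y z : F) (hz : z = x * y + T x * x ^ 2 + T y) :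
    x * y * T z + T y * y ^ 2 + T x * z ^ 2 = z * T z := by
  have h2 : (2 : F) = 0 := CharP.cast_eq_zero F 2
  have hTz : T z = T x * T y + x ^ 2 * T x ^ 2 + y ^ 2 := by
    rw [hz]; simp only [map_add, map_mul, map_pow, hT]
  rw [hTz, hz]
  linear_combination (x * y * T x * T y + x ^ 3 * y * T x ^ 2) * h2

/-- Two affine points of the ovoid collinear with the origin point `⟨(1, 0, 0, 0)⟩` agree with it. -/
theorem suzukiTits_collinear_origin {F : Type*} [Field F] [CharP F 2] (T : F →+* F)
    (hT : ∀ t, T (T t) = t ^ 2) {x y z x' y' z' k : F} (hz : z = x * y + T x * x ^ 2 + T y)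
    (hz' : z' = x' * y' + T x' * x' ^ 2 + T y') (hk : k ≠ 0) (hk1 : k ≠ 1)
    (hx : x' = k * x) (hy : y' = k * y) (hzz : z' = k * z) : x = 0 ∧ y = 0 := by
  have e := suzukiTits_inversion T hT x y z hz
  have e' := suzukiTits_inversion T hT x' y' z' hz'
  rw [hx, hy, hzz] at e'
  simp only [map_mul] at e'
  have hTk : T k ≠ 0 := (map_ne_zero T).mpr hk
  -- Under scaling by `k` the left side of the inversion identity picks up `T k * k ^ 2` but the
  -- right side only `T k * k`; as `k ≠ 1`, both sides vanish.
  have h : (T k * k * (k - 1)) * (z * T z) = 0 := by linear_combination e' - T k * k ^ 2 * e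
  have hz0 : z = 0 := by
    rcases mul_eq_zero.mp h with h | h
    · exact absurd h (mul_ne_zero (mul_ne_zero hTk hk) (sub_ne_zero.mpr hk1))
    · simpa using h
  have hy0 : y = 0 := by simpa [hz0] using e
  refine ⟨?_, hy0⟩
  simpa [hz0, hy0] using hz

/-- No three affine points of the Suzuki–Tits ovoid are collinear. -/
theorem suzukiTits_collinear {F : Type*} [Field F] [CharP F 2] (T : F →+* F)
    (hT : ∀ t, T (T t) = t ^ 2) {a b c x y x' y' x'' y'' : F} (ha : a ≠ 0) (hb : b ≠ 0) (hc : c ≠ 0)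
    (h0 : a = b + c) (h1 : a * x = b * x' + c * x'') (h2 : a * y = b * y' + c * y'')
    (h3 : a * (x * y + T x * x ^ 2 + T y) =
      b * (x' * y' + T x' * x' ^ 2 + T y') + c * (x'' * y'' + T x'' * x'' ^ 2 + T y'')) :
    x' = x ∧ y' = y := by
  have two : (2 : F) = 0 := CharP.cast_eq_zero F 2
  -- A shear moving `(x, y)` to the origin preserves the ovoid: the third coordinate changes by an
  -- affine function of the new coordinates, so collinearity is kept. The ratio `k` of the collinear
  -- points seen from the origin is `-b / c`.
  have hshear : ∀ u v : F, u * v + T u * u ^ 2 + T v =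
      ((u - x) * (v - y - T x * (u - x)) + T (u - x) * (u - x) ^ 2 +
        T (v - y - T x * (u - x))) + (x * y + T x * x ^ 2 + T y) + (u - x) * y +
        x * (v - y - T x * (u - x)) + x * T x * (u - x) := by
    intro u v
    simp only [map_sub, map_mul, hT]
    linear_combination (T u * u * x - 2 * T x * u * x + T x * u ^ 2) * two
  have hk1 : -b / c ≠ 1 := fun h => ha <| by
    rw [div_eq_one_iff_eq hc] at h
    linear_combination h0 - h
  have hkx : x'' - x = -b / c * (x' - x) := by
    field_simp
    linear_combination x * h0 - h1
  have hky : y'' - y - T x * (x'' - x) = -b / c * (y' - y - T x * (x' - x)) := by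
    field_simp
    linear_combination y * h0 - h2 - T x * (x * h0 - h1)
  rw [hshear x' y', hshear x'' y''] at h3
  obtain ⟨hX, hY⟩ := suzukiTits_collinear_origin T hT rfl rfl
    (div_ne_zero (neg_ne_zero.mpr hb) hc) hk1 hkx hky <| by
      rw [div_mul_eq_mul_div, eq_div_iff hc]
      linear_combination -h3 + (x * y + T x * x ^ 2 + T y) * h0 + y * (h1 - x * h0) + x *
        (h2 - y * h0 - T x * (h1 - x * h0)) + x * T x * (h1 - x * h0)
  have hX' : x' = x := sub_eq_zero.mp hX
  rw [hX', sub_self, mul_zero, sub_zero] at hY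
  exact ⟨hX', sub_eq_zero.mp hY⟩

/-- A triangle in the Suzuki graph through the origin has its vertices on a line. -/
theorem suzukiTitsCone_triangle {F : Type*} [Field F] [CharP F 2] (e : ℕ)
    (T : F →+* F) (hTe : ∀ t, T t = t ^ (2 ^ (e + 1))) (hT : ∀ t, T (T t) = t ^ 2)
    {u v : Fin 4 → F} (hu : u ∈ suzukiTitsCone e F) (hv : v ∈ suzukiTitsCone e F)
    (huv : u - v ∈ suzukiTitsCone e F) : ∃ k : F, v = k • u := by
  obtain ⟨a, ha, hu⟩ := hu
  obtain ⟨b, hb, hv⟩ := hv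
  obtain ⟨c, hc, huv⟩ := huv
  simp only [pow_add _ (2 ^ (e + 1)) 2, ← hTe] at hu hv huv
  have huv' : ∀ i, u i - v i = (u - v) i := fun i => rfl
  have g0 := huv' 0
  have g1 := huv' 1
  have g2 := huv' 2
  have g3 := huv' 3
  -- Eight cases, by which of `u`, `v`, `u - v` span `⟨(0, 0, 0, 1)⟩`. Exactly two is impossible by
  -- the coordinate `0`. If exactly one does, the other two have equal parameters, which is absurd
  -- or gives `u = v`. If none does, no three affine points being collinear applies.
  rcases hu with hu | ⟨x, y, hu⟩ <;> rcases hv with hv | ⟨x', y', hv⟩ <;>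
    rcases huv with huv | ⟨x'', y'', huv⟩ <;> rw [huv] at g0 g1 g2 g3 <;>
    rw [hu, hv] at g0 g1 g2 g3 <;>
    simp [-mul_eq_mul_left_iff, -mul_eq_zero, sub_eq_zero] at g0 g1 g2 g3
  · exact ⟨b / a, by rw [hu, hv, smul_smul, div_mul_cancel₀ _ ha]⟩
  · exact absurd g0.symm hc
  · exact absurd g0 hb
  · have hx : x' = x'' := by
      refine mul_left_cancel₀ hb ?_
      linear_combination -g1 + x'' * g0
    have hy : y' = y'' := by
      refine mul_left_cancel₀ hb ?_
      linear_combination -g2 + y'' * g0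
    rw [← hx, ← hy, ← g0] at g3
    exact absurd (by linear_combination g3) ha
  · exact absurd g0 ha
  · have hx : x = x'' := mul_left_cancel₀ ha (by rw [g1, g0])
    have hy : y = y'' := mul_left_cancel₀ ha (by rw [g2, g0])
    rw [← hx, ← hy, ← g0] at g3
    exact absurd (by linear_combination -g3) hb
  · have hx : x = x' := mul_left_cancel₀ ha (by rw [g1, g0])
    have hy : y = y' := mul_left_cancel₀ ha (by rw [g2, g0])
    exact ⟨1, by rw [hu, hv, hx, hy, g0, one_smul]⟩
  · obtain ⟨rfl, rfl⟩ := suzukiTits_collinear T hT (x := x) (y := y) (x' := x') (y' := y')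
      (x'' := x'') (y'' := y'') ha hb hc (by linear_combination g0)
      (by linear_combination g1) (by linear_combination g2) (by linear_combination g3)
    exact ⟨b / a, by rw [hu, hv, smul_smul, div_mul_cancel₀ _ ha]⟩

/-- Each nonzero functional vanishes at some point of the Suzuki–Tits ovoid. -/
theorem exists_mem_suzukiTitsCone {F : Type*} [Field F] [Finite F] (e : ℕ)
    (T : F →+* F) (hTe : ∀ t, T t = t ^ (2 ^ (e + 1))) (φ : Module.Dual F (Fin 4 → F)) :
    ∃ v, v ≠ 0 ∧ (∀ c : F, c ≠ 0 → c • v ∈ suzukiTitsCone e F) ∧ φ v = 0 := by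
  have hφ : ∀ a b c d : F, φ ![a, b, c, d] = a * φ (Pi.single 0 1) + b * φ (Pi.single 1 1) +
      c * φ (Pi.single 2 1) + d * φ (Pi.single 3 1) := by
    intro a b c d
    rw [show ![a, b, c, d] = a • (Pi.single 0 1 : Fin 4 → F) + b • (Pi.single 1 1 : Fin 4 → F) +
      c • (Pi.single 2 1 : Fin 4 → F) + d • (Pi.single 3 1 : Fin 4 → F) by
        ext i; fin_cases i <;> simp]
    simp only [map_add, map_smul, smul_eq_mul]
  by_cases h3 : φ (Pi.single 3 1) = 0
  · refine ⟨![0, 0, 0, 1], fun h => one_ne_zero (congrFun h 3), fun c hc => ⟨c, hc, Or.inl rfl⟩, ?_⟩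
    rw [hφ, h3]; ring
  · have hsurj : Function.Surjective T := Finite.surjective_of_injective T.injective
    -- This `x` cancels the terms of `φ` linear in `y`, leaving a linear equation for `T y`,
    -- solvable because `T` is surjective on a finite field.
    set x := -φ (Pi.single 2 1) / φ (Pi.single 3 1)
    obtain ⟨y, hy⟩ := hsurj
      (-(φ (Pi.single 0 1) + x * φ (Pi.single 1 1)) / φ (Pi.single 3 1) - T x * x ^ 2)
    refine ⟨![1, x, y, x * y + T x * x ^ 2 + T y], fun h => one_ne_zero (congrFun h 0),
      fun c hc => ⟨c, hc, Or.inr ⟨x, y, ?_⟩⟩, ?_⟩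
    · rw [pow_add, ← hTe, ← hTe]
    · have hx : x * φ (Pi.single 3 1) = -φ (Pi.single 2 1) := div_mul_cancel₀ _ h3
      have hy' : T y * φ (Pi.single 3 1) = -(φ (Pi.single 0 1) + x * φ (Pi.single 1 1)) -
          T x * x ^ 2 * φ (Pi.single 3 1) := by
        rw [hy, sub_mul, div_mul_cancel₀ _ h3]
      rw [hφ]
      linear_combination hy' + y * hx

/-- The criterion applies with `N = q`: two vertices of a clique determine a line containing all the
others, and a point of the ovoid in the kernel of `φ` spans the required subspace. -/
theorem separatingGraph_suzukiGraph (F : Type*) [Field F] [Finite F] (e : ℕ)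
    (hF : Nat.card F = 2 ^ (2 * e + 1)) : SeparatingGraph (suzukiGraph e F) := by
  classical
  have := Fintype.ofFinite F
  have hF' : Fintype.card F = 2 ^ (2 * e + 1) := by rw [← hF, Nat.card_eq_fintype_card]
  have : Fact (Nat.Prime 2) := ⟨Nat.prime_two⟩
  have hchar : CharP F 2 := charP_of_card_eq_prime_pow hF'
  set T : F →+* F := iterateFrobenius F 2 (e + 1)
  have hTe : ∀ t, T t = t ^ (2 ^ (e + 1)) := fun t => iterateFrobenius_def 2 (e + 1) t
  have hT : ∀ t, T (T t) = t ^ 2 := by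
    intro t
    rw [hTe, hTe, ← pow_mul, ← pow_add, show e + 1 + (e + 1) = 2 * e + 1 + 1 by ring, pow_succ 2,
      pow_mul, ← hF', FiniteField.pow_card]
  refine separatingGraph_of_clique_subspaces (F := F) (suzukiGraph e F) (Equiv.refl _)
    (suzukiTitsCone e F) (fun u v => Iff.rfl) (Nat.card F) Finite.one_lt_card ?_ ?_
  · intro s hs
    by_cases hs1 : s.card ≤ 1
    · exact hs1.trans Nat.card_pos
    · obtain ⟨a, ha, b, hb, hab⟩ := Finset.one_lt_card.mp (not_le.mp hs1)
      have hsub : s ⊆ Finset.univ.image fun k : F => k • (b - a) + a := by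
        intro v hv
        rw [Finset.mem_image]
        by_cases hva : v = a
        · exact ⟨0, Finset.mem_univ _, by simp [hva]⟩
        by_cases hvb : v = b
        · exact ⟨1, Finset.mem_univ _, by simp [hvb]⟩
        obtain ⟨k, hk⟩ := suzukiTitsCone_triangle e T hTe hT (hs hb ha hab.symm) (hs hv ha hva)
          (by rw [sub_sub_sub_cancel_right]; exact hs hb hv (Ne.symm hvb))
        exact ⟨k, Finset.mem_univ _, by rw [← hk, sub_add_cancel]⟩
      rw [Nat.card_eq_fintype_card]
      exact (Finset.card_le_card hsub).trans Finset.card_image_le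
  · intro φ _
    obtain ⟨v, hv0, hv, hφv⟩ := exists_mem_suzukiTitsCone e T hTe φ
    refine ⟨Submodule.span F {v}, ?_, ?_, ?_⟩
    · rw [Module.natCard_eq_pow_finrank (K := F), finrank_span_singleton hv0, pow_one]
    · intro x hx hx0
      obtain ⟨c, rfl⟩ := Submodule.mem_span_singleton.mp hx
      exact hv c fun h => hx0 (by rw [h, zero_smul])
    · intro x hx
      obtain ⟨c, rfl⟩ := Submodule.mem_span_singleton.mp hx
      rw [map_smul, hφv, smul_zero]

/-! ### Pfaffians and spaces of alternating forms of rank at most two. -/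

/-- A quadratic form that vanishes on a set and on all differences of its members vanishes on the
span. -/
theorem QuadraticMap.eq_zero_of_mem_span {F M : Type*} [Field F] [AddCommGroup M] [Module F M]
    (Q : QuadraticForm F M) {D : Set M} (h : ∀ x ∈ D, Q x = 0)
    (hsub : ∀ x ∈ D, ∀ y ∈ D, Q (x - y) = 0) {x : M} (hx : x ∈ Submodule.span F D) :
    Q x = 0 := by
  -- Working with the polar form avoids division by `2`, so even characteristic is covered.
  have hpol : ∀ x ∈ D, ∀ y ∈ D, Q.polarBilin x y = 0 := by
    intro x hx y hy
    have := hsub x hx y hy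
    rw [sub_eq_add_neg, QuadraticMap.map_add Q, QuadraticMap.map_neg, h x hx, h y hy,
      QuadraticMap.polar_neg_right] at this
    simpa using this
  have hpol1 : ∀ y ∈ D, ∀ x ∈ Submodule.span F D, Q.polarBilin x y = 0 := by
    intro y hy x hx
    induction hx using Submodule.span_induction with
    | mem x hx => exact hpol x hx y hy
    | zero => simp
    | add u v _ _ hu hv => rw [map_add, LinearMap.add_apply, hu, hv, add_zero]
    | smul c u _ hu => rw [map_smul, LinearMap.smul_apply, hu, smul_zero]
  have hpol2 : ∀ x ∈ Submodule.span F D, ∀ y ∈ Submodule.span F D, Q.polarBilin x y = 0 := by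
    intro x hx y hy
    induction hy using Submodule.span_induction with
    | mem y hy => exact hpol1 y hy x hx
    | zero => simp
    | add u v _ _ hu hv => rw [map_add, hu, hv, add_zero]
    | smul c u _ hu => rw [map_smul, hu, smul_zero]
  induction hx using Submodule.span_induction with
  | mem x hx => exact h x hx
  | zero => simp
  | add u v hu hv hu' hv' =>
    rw [QuadraticMap.map_add Q, hu', hv', ← QuadraticMap.polarBilin_apply_apply, hpol2 u hu v hv]
    simp
  | smul c u _ hu => rw [QuadraticMap.map_smul, hu, smul_zero]

section Pfaffian

variable {F V : Type*} [Field F] [AddCommGroup V] [Module F V]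

/-- The Pfaffian of the Gram matrix of an alternating form on four vectors. -/
def gramPfaffian (B : V →ₗ[F] V →ₗ[F] F) (a b c d : V) : F :=
  B a b * B c d - B a c * B b d + B a d * B b c

/-- Evaluation at a pair of vectors of the members of a linear family of bilinear forms. -/
def bilinEval {M : Type*} [AddCommGroup M] [Module F M] (β : M →ₗ[F] V →ₗ[F] V →ₗ[F] F) (a b : V) :
    M →ₗ[F] F :=
  (LinearMap.applyₗ b).comp ((LinearMap.applyₗ a).comp β)

/-- The Pfaffian of the Gram matrix on four given vectors, as a quadratic form on a linear family of
bilinear forms. -/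
def gramPfaffianForm {M : Type*} [AddCommGroup M] [Module F M] (β : M →ₗ[F] V →ₗ[F] V →ₗ[F] F)
    (a b c d : V) : QuadraticForm F M :=
  QuadraticMap.linMulLin (bilinEval β a b) (bilinEval β c d) -
    QuadraticMap.linMulLin (bilinEval β a c) (bilinEval β b d) +
    QuadraticMap.linMulLin (bilinEval β a d) (bilinEval β b c)

theorem gramPfaffianForm_apply {M : Type*} [AddCommGroup M] [Module F M]
    (β : M →ₗ[F] V →ₗ[F] V →ₗ[F] F) (a b c d : V) (m : M) :
    gramPfaffianForm β a b c d m = gramPfaffian (β m) a b c d := rfl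

/-- Bounds a space of forms by the size of a set of coordinates that determines its members. -/
theorem finrank_le_of_injOn_prod {M N P : Type*} [AddCommGroup M] [Module F M] [AddCommGroup N]
    [Module F N] [FiniteDimensional F N] [AddCommGroup P] [Module F P] [FiniteDimensional F P]
    (S : Submodule F M) (f : M →ₗ[F] N) (g : M →ₗ[F] P) (h : ∀ x ∈ S, f x = 0 → g x = 0 → x = 0) :
    Module.finrank F S ≤ Module.finrank F N + Module.finrank F P := by
  rw [← Module.finrank_prod]
  refine LinearMap.finrank_le_finrank_of_injective (f := (f.prod g).comp S.subtype) ?_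
  rw [← LinearMap.ker_eq_bot, LinearMap.ker_eq_bot']
  rintro ⟨x, hx⟩ hfx
  exact Subtype.ext (h x hx (congrArg Prod.fst hfx) (congrArg Prod.snd hfx))

theorem neg_swap_of_alternating (B : V →ₗ[F] V →ₗ[F] F) (h : ∀ x, B x x = 0) (x y : V) :
    B y x = -B x y := by
  have := h (x + y)
  simp only [map_add, LinearMap.add_apply, h] at this
  linear_combination this

variable {M : Type*} [AddCommGroup M] [Module F M] (β : M →ₗ[F] V →ₗ[F] V →ₗ[F] F)

/-- A space of alternating forms of rank at most `2` on a `5`-dimensional space has dimension at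
most `4`. -/
theorem finrank_le_four_of_gramPfaffian_eq_zero [FiniteDimensional F V]
    (hV : Module.finrank F V = 5) (hβ : ∀ m, β m = 0 → m = 0) (S : Submodule F M)
    (halt : ∀ m ∈ S, ∀ x, β m x x = 0) (hpf : ∀ m ∈ S, ∀ a b c d, gramPfaffian (β m) a b c d = 0) :
    Module.finrank F S ≤ 4 := by
  by_cases hS : S = ⊥
  · rw [hS, finrank_bot]; omega
  obtain ⟨A, hA, hA0⟩ := S.ne_bot_iff.mp hS
  obtain ⟨a, b, hab⟩ : ∃ a b, β A a b ≠ 0 := by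
    by_contra! h
    exact hA0 (hβ A (LinearMap.ext₂ h))
  -- `V` splits as `⟨a, b⟩ ⊕ K` with `K` of dimension `3`, and `K` is the radical of `A`.
  set K : Submodule F V := LinearMap.ker ((β A a).prod (β A b)) with hK
  have hKmem : ∀ x, x ∈ K ↔ β A a x = 0 ∧ β A b x = 0 := by
    intro x; simp [hK]
  have hba : β A b a = -β A a b := neg_swap_of_alternating (β A) (halt A hA) a b
  have hsurj : Function.Surjective ((β A a).prod (β A b)) := by
    rintro ⟨s, t⟩
    refine ⟨(s / β A a b) • b - (t / β A a b) • a, ?_⟩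
    have h1 := halt A hA a
    have h2 := halt A hA b
    refine Prod.ext ?_ ?_
    · change β A a _ = s
      rw [map_sub, map_smul, map_smul, h1, smul_zero, sub_zero, smul_eq_mul, div_mul_cancel₀ _ hab]
    · change β A b _ = t
      rw [map_sub, map_smul, map_smul, h2, hba, smul_zero, smul_eq_mul, zero_sub, mul_neg, neg_neg,
        div_mul_cancel₀ _ hab]
  have hKdim : Module.finrank F K = 3 := by
    have h1 := LinearMap.finrank_range_add_finrank_ker ((β A a).prod (β A b))
    rw [LinearMap.range_eq_top.mpr hsurj, finrank_top, Module.finrank_prod, Module.finrank_self,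
      hV, ← hK] at h1
    omega
  have hAK : ∀ x ∈ K, ∀ y ∈ K, β A x y = 0 := by
    intro x hx y hy
    have := hpf A hA a b x y
    rw [gramPfaffian, ((hKmem x).mp hx).1, ((hKmem x).mp hx).2] at this
    simpa [hab] using this
  -- Adding `A` to `B` changes the Pfaffian at `a, b, x, y` by exactly `A(a, b) * B(x, y)`.
  have hBK : ∀ B ∈ S, ∀ x ∈ K, ∀ y ∈ K, β B x y = 0 := by
    intro B hB x hx y hy
    have h1 := hpf (B + A) (S.add_mem hB hA) a b x y
    have h2 := hpf B hB a b x y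
    simp only [gramPfaffian, map_add, LinearMap.add_apply, hAK x hx y hy, ((hKmem x).mp hx).1,
      ((hKmem y).mp hy).1, ((hKmem x).mp hx).2, ((hKmem y).mp hy).2] at h1 h2
    have : β A a b * β B x y = 0 := by linear_combination h1 - h2
    simpa [hab] using this
  -- So `B` is determined by `B(a, b)` and the two rows `B(a, ·)`, `B(b, ·)` on `K`, which form a `2
  -- × 3` matrix of rank at most `1`.
  have hminor : ∀ B ∈ S, ∀ x ∈ K, ∀ y ∈ K, β B a x * β B b y = β B a y * β B b x := by
    intro B hB x hx y hy
    have h2 := hpf B hB a b x y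
    rw [gramPfaffian, hBK B hB x hx y hy] at h2
    linear_combination -h2
  have hpolar : ∀ B ∈ S, ∀ B' ∈ S, ∀ x ∈ K, ∀ y ∈ K,
      β B a x * β B' b y + β B' a x * β B b y = β B a y * β B' b x + β B' a y * β B b x := by
    intro B hB B' hB' x hx y hy
    have h1 := hminor (B + B') (S.add_mem hB hB') x hx y hy
    have h2 := hminor B hB x hx y hy
    have h3 := hminor B' hB' x hx y hy
    simp only [map_add, LinearMap.add_apply] at h1
    linear_combination h1 - h2 - h3
  have hdecomp : ∀ v, ∃ s t : F, ∃ k ∈ K, v = s • a + t • b + k := by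
    intro v
    refine ⟨-β A b v / β A a b, β A a v / β A a b, v - ((-β A b v / β A a b) • a + (β A a v / β A a b) • b), ?_,
      by abel⟩
    have h1 := halt A hA a
    have h2 := halt A hA b
    rw [hKmem]
    simp only [map_sub, map_add, map_smul, smul_eq_mul, hba, h1, h2]
    constructor <;> field_simp <;> ring
  have hzero : ∀ B ∈ S, β B a b = 0 → (∀ x ∈ K, β B a x = 0) → (∀ x ∈ K, β B b x = 0) → B = 0 := by
    intro B hB hBab hBa hBb
    have hB' : ∀ x y, β B y x = -β B x y := neg_swap_of_alternating (β B) (halt B hB)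
    refine hβ B (LinearMap.ext₂ fun u v => ?_)
    obtain ⟨s, t, k, hk, rfl⟩ := hdecomp u
    obtain ⟨s', t', k', hk', rfl⟩ := hdecomp v
    simp [hB' a b, hBab, hBa k' hk', hBb k' hk', hB' a k, hB' b k, hBa k hk, hBb k hk,
      hBK B hB k hk k' hk', halt B hB a, halt B hB b]
  have hKdual : Module.finrank F F + Module.finrank F (Module.Dual F K) = 4 := by
    rw [Subspace.dual_finrank_eq, hKdim, Module.finrank_self]
  let ra : V → (M →ₗ[F] Module.Dual F K) := fun c =>
    (LinearMap.lcomp F F K.subtype).comp ((LinearMap.applyₗ c).comp β)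
  have hra : ∀ c B (x : K), ra c B x = β B c x := fun c B x => rfl
  -- If row `a` determines row `b`, the coordinates are `B(a, b)` and row `a`: dimension at most `1
  -- + 3`. Otherwise some `B₀` has only row `b` nonzero. Either all rows `a` vanish, giving `1 + 3`
  -- again, or polarizing with `B₀` and then with some `B₁` having nonzero row `a` makes all rows
  -- multiples of one functional, giving `1 + 2`.
  by_cases hcase : ∃ B₀ ∈ S, (∀ x ∈ K, β B₀ a x = 0) ∧ ∃ x ∈ K, β B₀ b x ≠ 0
  · clear hdecomp hsurj hKdim
    obtain ⟨B₀, hB₀, hB₀a, x₀, hx₀, hw⟩ := hcase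
    by_cases hall : ∀ B ∈ S, ∀ x ∈ K, β B a x = 0
    · refine hKdual ▸ finrank_le_of_injOn_prod S (bilinEval β a b) (ra b) fun B hB h1 h2 => ?_
      exact hzero B hB h1 (hall B hB) fun x hx => by
        have := LinearMap.congr_fun h2 ⟨x, hx⟩
        rwa [hra] at this
    · push Not at hall
      obtain ⟨B₁, hB₁, x₁, hx₁, hB₁a⟩ := hall
      have hrow : ∀ B ∈ S, ∀ y ∈ K, β B a x₀ * β B₀ b y = β B a y * β B₀ b x₀ := by
        intro B hB y hy
        have := hpolar B hB B₀ hB₀ x₀ hx₀ y hy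
        rw [hB₀a x₀ hx₀, hB₀a y hy] at this
        linear_combination this
      have hB₁0 : β B₁ a x₀ ≠ 0 := by
        intro h
        have := hrow B₁ hB₁ x₁ hx₁
        rw [h, zero_mul] at this
        exact mul_ne_zero hB₁a hw this.symm
      have : Module.finrank F S ≤ Module.finrank F F + Module.finrank F (F × F) := by
        refine finrank_le_of_injOn_prod S (bilinEval β a b) ((bilinEval β a x₀).prod
          (bilinEval β b x₀)) fun B hB h1 h => ?_
        have h2 : β B a x₀ = 0 := congrArg Prod.fst h
        have h3 : β B b x₀ = 0 := congrArg Prod.snd h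
        have hBa : ∀ y ∈ K, β B a y = 0 := by
          intro y hy
          have := hrow B hB y hy
          rw [h2, zero_mul] at this
          exact (mul_eq_zero.mp this.symm).resolve_right hw
        refine hzero B hB h1 hBa fun y hy => ?_
        have := hpolar B hB B₁ hB₁ x₀ hx₀ y hy
        rw [h2, h3, hBa y hy] at this
        simpa [hB₁0] using this
      simp only [Module.finrank_prod, Module.finrank_self] at this
      omega
  · push Not at hcase
    refine hKdual ▸ finrank_le_of_injOn_prod S (bilinEval β a b) (ra a) fun B hB h1 h2 => ?_
    have hBa : ∀ x ∈ K, β B a x = 0 := fun x hx => by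
      have := LinearMap.congr_fun h2 ⟨x, hx⟩
      rwa [hra] at this
    exact hzero B hB h1 hBa (hcase B hB hBa)

/-- A set of alternating forms on a `5`-dimensional space over a finite field, with pairwise
differences of rank at most `2`, has at most `q ^ 4` elements. -/
theorem card_le_pow_four_of_gramPfaffian_sub_eq_zero [Finite F] [FiniteDimensional F V]
    [FiniteDimensional F M] (hV : Module.finrank F V = 5) (hβ : ∀ m, β m = 0 → m = 0) (C : Finset M)
    (halt : ∀ m ∈ C, ∀ x, β m x x = 0)
    (hpf : ∀ m ∈ C, ∀ n ∈ C, ∀ a b c d, gramPfaffian (β (m - n)) a b c d = 0) :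
    C.card ≤ Nat.card F ^ 4 := by
  rcases C.eq_empty_or_nonempty with rfl | ⟨A, hA⟩
  · simp
  set D : Set M := (· - A) '' C with hD
  set S := Submodule.span F D
  have hSalt : ∀ B ∈ S, ∀ x, β B x x = 0 := by
    intro B hB x
    induction hB using Submodule.span_induction with
    | mem B hB =>
      obtain ⟨B, hB, rfl⟩ := hB
      simp [halt B hB x, halt A hA x]
    | zero => simp
    | add u v _ _ hu hv => simp [hu, hv]
    | smul c u _ hu => simp [hu]
  have hSpf : ∀ B ∈ S, ∀ a b c d, gramPfaffian (β B) a b c d = 0 := by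
    intro B hB a b c d
    rw [← gramPfaffianForm_apply]
    refine QuadraticMap.eq_zero_of_mem_span _ ?_ ?_ hB
    · rintro _ ⟨B, hB, rfl⟩
      exact hpf B hB A hA a b c d
    · rintro _ ⟨B, hB, rfl⟩ _ ⟨B', hB', rfl⟩
      rw [sub_sub_sub_cancel_right]
      exact hpf B hB B' hB' a b c d
  have hdim := finrank_le_four_of_gramPfaffian_eq_zero β hV hβ S hSalt hSpf
  have hfin : Finite S := Module.finite_of_finite F
  have hle : C.card ≤ Nat.card S := by
    have h1 : D.ncard = C.card := by
      rw [hD, Set.ncard_image_of_injective _ sub_left_injective, Set.ncard_coe_finset]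
    rw [← h1, ← SetLike.coe_sort_coe, Nat.card_coe_set_eq]
    exact Set.ncard_le_ncard Submodule.subset_span (Set.toFinite _)
  refine hle.trans ?_
  rw [Module.natCard_eq_pow_finrank (K := F)]
  exact Nat.pow_le_pow_right Nat.card_pos hdim

end Pfaffian

/-! ### The alternating forms graph. -/

section AltFormsGraph

variable {F : Type*} [Field F]

/-- A Gram matrix on more vectors than the rank of the form is singular, since products do not raise
rank. -/
theorem Matrix.det_mul_mul_transpose_eq_zero_of_rank_lt {m n : ℕ} (M : Matrix (Fin m) (Fin m) F)
    (hM : M.rank < n) (P : Matrix (Fin n) (Fin m) F) : (P * M * P.transpose).det = 0 := by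
  by_contra h
  have h1 : (P * M * P.transpose).rank = Fintype.card (Fin n) :=
    Matrix.rank_of_isUnit _ ((Matrix.isUnit_iff_isUnit_det _).mpr (isUnit_iff_ne_zero.mpr h))
  have h2 : (P * M * P.transpose).rank ≤ M.rank :=
    (Matrix.rank_mul_le_left _ _).trans (Matrix.rank_mul_le_right _ _)
  rw [Fintype.card_fin] at h1
  omega

theorem toLinearMap₂'_self_eq_zero {M : Matrix (Fin 5) (Fin 5) F} (hM : M.transpose = -M)
    (hd : ∀ i, M i i = 0) (x : Fin 5 → F) :
    (Matrix.toLinearMap₂' F M : (Fin 5 → F) →ₗ[F] (Fin 5 → F) →ₗ[F] F) x x = 0 := by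
  have hs : ∀ i j, M i j = -M j i := fun i j => by
    rw [← Matrix.transpose_apply M, hM, Matrix.neg_apply]
  rw [Matrix.toLinearMap₂'_apply]
  simp only [Fin.sum_univ_five, hd, hs 1 0, hs 2 0, hs 3 0, hs 4 0, hs 2 1, hs 3 1, hs 4 1, hs 3 2,
    hs 4 2, hs 4 3, smul_eq_mul]
  ring

/-- The Gram Pfaffians of an alternating form of rank at most `2` vanish. -/
theorem gramPfaffian_eq_zero_of_rank_le {M : Matrix (Fin 5) (Fin 5) F} (hM : M.transpose = -M)
    (hd : ∀ i, M i i = 0) (hr : M.rank ≤ 2) (a b c d : Fin 5 → F) :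
    gramPfaffian (Matrix.toLinearMap₂' F M) a b c d = 0 := by
  set B : (Fin 5 → F) →ₗ[F] (Fin 5 → F) →ₗ[F] F := Matrix.toLinearMap₂' F M with hB
  have halt : ∀ x, B x x = 0 := toLinearMap₂'_self_eq_zero hM hd
  have hs : ∀ x y, B y x = -B x y := neg_swap_of_alternating B halt
  set p : Fin 4 → Fin 5 → F := ![a, b, c, d]
  have hG : Matrix.of p * M * (Matrix.of p).transpose = Matrix.of fun i j => B (p i) (p j) := by
    ext i j
    rw [Matrix.mul_assoc, Matrix.of_apply, hB, Matrix.toLinearMap₂'_apply', Matrix.mul_apply]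
    rfl
  have hdet := Matrix.det_mul_mul_transpose_eq_zero_of_rank_lt M (n := 4) (by omega) (Matrix.of p)
  have hG' : (Matrix.of fun i j => B (p i) (p j)) = !![0, B a b, B a c, B a d;
      -B a b, 0, B b c, B b d; -B a c, -B b c, 0, B c d; -B a d, -B b d, -B c d, 0] := by
    ext i j
    fin_cases i <;> fin_cases j <;> first | exact halt _ | exact hs _ _ | rfl
  rw [hG, hG'] at hdet
  -- The `4 × 4` alternating determinant is the square of its Pfaffian.
  have : gramPfaffian B a b c d ^ 2 = 0 := by
    rw [← hdet, gramPfaffian]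
    generalize B a b = x01, B a c = x02, B a d = x03, B b c = x12, B b d = x13, B c d = x23
    simp [Matrix.det_succ_row_zero, Fin.sum_univ_succ, Fin.succAbove]
    ring
  exact pow_eq_zero_iff (by norm_num) |>.mp this

/-- A nonzero alternating matrix has rank at least `2`. -/
theorem two_le_rank_of_alternating {n : ℕ} {M : Matrix (Fin n) (Fin n) F} (hM : M.transpose = -M)
    (hd : ∀ i, M i i = 0) (h0 : M ≠ 0) : 2 ≤ M.rank := by
  by_contra hr
  obtain ⟨i, j, hij⟩ : ∃ i j, M i j ≠ 0 := by
    by_contra! h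
    exact h0 (Matrix.ext h)
  have hji : M j i = -M i j := by
    rw [← Matrix.transpose_apply M, hM, Matrix.neg_apply]
  -- The principal minor on `i, j` is `M i j ^ 2`.
  have hdet := Matrix.det_mul_mul_transpose_eq_zero_of_rank_lt M (n := 2) (by omega)
    (Matrix.of ![Pi.single i 1, Pi.single j 1])
  rw [Matrix.det_fin_two] at hdet
  simp [Matrix.mul_apply, Pi.single_apply, hd, hji, hij] at hdet

/-- The space of alternating `n × n` matrices. -/
def altSubmodule (n : ℕ) (F : Type*) [Field F] : Submodule F (Matrix (Fin n) (Fin n) F) where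
  carrier := {A | A.transpose = -A ∧ ∀ i, A i i = 0}
  add_mem' := by
    rintro A B ⟨hA, hA'⟩ ⟨hB, hB'⟩
    refine ⟨by rw [Matrix.transpose_add, hA, hB, neg_add], fun i => ?_⟩
    rw [Matrix.add_apply, hA', hB', add_zero]
  zero_mem' := by simp
  smul_mem' := by
    rintro c A ⟨hA, hA'⟩
    refine ⟨by rw [Matrix.transpose_smul, hA, smul_neg], fun i => ?_⟩
    rw [Matrix.smul_apply, hA', smul_zero]

/-- The exterior product of two vectors as an alternating matrix. -/
def wedgeMatrix (n : ℕ) (F : Type*) [Field F] :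
    (Fin n → F) →ₗ[F] (Fin n → F) →ₗ[F] altSubmodule n F :=
  LinearMap.mk₂ F
    (fun a w => ⟨Matrix.vecMulVec a w - Matrix.vecMulVec w a, by
      rw [Matrix.transpose_sub, Matrix.transpose_vecMulVec, Matrix.transpose_vecMulVec, neg_sub],
      fun i => by simp [Matrix.vecMulVec_apply, mul_comm]⟩)
    (fun a a' w => by
      ext i j; simp [Matrix.vecMulVec_apply]; ring)
    (fun c a w => by
      ext i j; simp [Matrix.vecMulVec_apply]; ring)
    (fun a w w' => by
      ext i j; simp [Matrix.vecMulVec_apply]; ring)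
    (fun c a w => by
      ext i j; simp [Matrix.vecMulVec_apply]; ring)

theorem wedgeMatrix_apply {n : ℕ} (a w : Fin n → F) (i j : Fin n) :
    (wedgeMatrix n F a w : Matrix (Fin n) (Fin n) F) i j = a i * w j - w i * a j := rfl

theorem wedgeMatrix_self {n : ℕ} (a : Fin n → F) : wedgeMatrix n F a a = 0 := by
  ext i j; rw [wedgeMatrix_apply]; simp

theorem ker_wedgeMatrix {n : ℕ} {a : Fin n → F} (ha : a ≠ 0) :
    LinearMap.ker (wedgeMatrix n F a) = Submodule.span F {a} := by
  refine le_antisymm (fun w hw => ?_) ?_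
  · obtain ⟨i, hi⟩ := Function.ne_iff.mp ha
    rw [Submodule.mem_span_singleton]
    refine ⟨w i / a i, ?_⟩
    ext j
    have h : a i * w j - w i * a j = 0 := by
      rw [← wedgeMatrix_apply, LinearMap.mem_ker.mp hw]; rfl
    simp only [Pi.zero_apply] at hi
    rw [Pi.smul_apply, smul_eq_mul]
    field_simp
    linear_combination -h
  · rw [Submodule.span_singleton_le_iff_mem, LinearMap.mem_ker, wedgeMatrix_self]

theorem rank_wedgeMatrix {n : ℕ} {a w : Fin n → F} (h : wedgeMatrix n F a w ≠ 0) :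
    (wedgeMatrix n F a w : Matrix (Fin n) (Fin n) F).rank = 2 := by
  refine le_antisymm ?_ (two_le_rank_of_alternating (wedgeMatrix n F a w).2.1
    (wedgeMatrix n F a w).2.2 fun h' => h (Subtype.ext h'))
  have : (wedgeMatrix n F a w : Matrix (Fin n) (Fin n) F) =
      (Matrix.of ![a, w]).transpose * Matrix.of ![w, -a] := by
    ext i j
    rw [wedgeMatrix_apply]
    simp [Matrix.mul_apply, Fin.sum_univ_two]
    ring
  rw [this]
  exact (Matrix.rank_mul_le_left _ _).trans (Matrix.rank_le_width _)

theorem separatingGraph_altFormsGraph (F : Type*) [Field F] [Finite F] :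
    SeparatingGraph (altFormsGraph 5 F) := by
  classical
  have : Nontrivial (altSubmodule 5 F) := by
    refine ⟨wedgeMatrix 5 F (Pi.single 0 1) (Pi.single 1 1), 0, fun h => ?_⟩
    have := congrFun (congrFun (congrArg Subtype.val h) 0) 1
    rw [wedgeMatrix_apply] at this
    simp at this
  have : Finite (altSubmodule 5 F) := Module.finite_of_finite F
  refine separatingGraph_of_clique_subspaces (F := F) (altFormsGraph 5 F)
    (W := altSubmodule 5 F) (Equiv.refl _) {A | (A : Matrix (Fin 5) (Fin 5) F).rank = 2}
    (fun u v => Iff.rfl) (Nat.card F ^ 4) (Nat.one_lt_pow (by norm_num) Finite.one_lt_card) ?_ ?_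
  · intro s hs
    have hcard : (s.map (Function.Embedding.subtype _)).card = s.card := Finset.card_map _
    rw [← hcard]
    refine card_le_pow_four_of_gramPfaffian_sub_eq_zero (V := Fin 5 → F)
      (Matrix.toLinearMap₂' F).toLinearMap (by simp)
      (fun m hm => (LinearEquiv.map_eq_zero_iff _).mp hm) _ ?_ ?_
    · intro m hm x
      obtain ⟨m, -, rfl⟩ := Finset.mem_map.mp hm
      exact toLinearMap₂'_self_eq_zero m.2.1 m.2.2 x
    · intro m hm n hn a b c d
      obtain ⟨m, hms, rfl⟩ := Finset.mem_map.mp hm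
      obtain ⟨n, hns, rfl⟩ := Finset.mem_map.mp hn
      have hmem : m.1 - n.1 ∈ altSubmodule 5 F := Submodule.sub_mem _ m.2 n.2
      refine gramPfaffian_eq_zero_of_rank_le hmem.1 hmem.2 ?_ a b c d
      by_cases hmn : m = n
      · simp [hmn]
      · exact le_of_eq (hs hms hns hmn)
  · intro φ _
    -- For `a` in the radical of `(a, w) ↦ φ (a ∧ w)`, the space `a ∧ F ^ 5` lies in the kernel of
    -- `φ`. It has dimension `5 - 1`, as only multiples of `a` are killed.
    obtain ⟨a, ha, hφ⟩ := exists_ne_zero_of_alternating_five ((wedgeMatrix 5 F).compr₂ φ)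
      (fun x => by rw [LinearMap.compr₂_apply, wedgeMatrix_self, map_zero])
    refine ⟨LinearMap.range (wedgeMatrix 5 F a), ?_, ?_, ?_⟩
    · rw [Module.natCard_eq_pow_finrank (K := F)]
      have := LinearMap.finrank_range_add_finrank_ker (wedgeMatrix 5 F a)
      rw [ker_wedgeMatrix ha, finrank_span_singleton ha, Module.finrank_fin_fun] at this
      rw [show Module.finrank F (LinearMap.range (wedgeMatrix 5 F a)) = 4 by omega]
    · rintro _ ⟨w, rfl⟩ hw
      exact rank_wedgeMatrix hw
    · rintro _ ⟨w, rfl⟩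
      exact hφ w

end AltFormsGraph

/-! ### The spin representation and operators preserving purity. -/

section Spinors

open CliffordAlgebra (contractLeft)
open ExteriorAlgebra (ι)

variable {F W : Type*} [Field F] [AddCommGroup W] [Module F W]

theorem spinAction_apply (x : W × Module.Dual F W) (ψ : ExteriorAlgebra F W) :
    spinAction F W x ψ = ι F x.1 * ψ + contractLeft x.2 ψ := rfl

theorem ExteriorAlgebra.contractLeft_ι_mul (d : Module.Dual F W) (a : W) (b : ExteriorAlgebra F W) :
    contractLeft d (ι F a * b) = d a • b - ι F a * contractLeft d b :=
  CliffordAlgebra.contractLeft_ι_mul d a b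

theorem ExteriorAlgebra.contractLeft_comm (d d' : Module.Dual F W) (ψ : ExteriorAlgebra F W) :
    contractLeft d (contractLeft d' ψ) = -contractLeft d' (contractLeft d ψ) :=
  CliffordAlgebra.contractLeft_comm d d' ψ

theorem ExteriorAlgebra.contractLeft_contractLeft (d : Module.Dual F W) (ψ : ExteriorAlgebra F W) :
    contractLeft d (contractLeft d ψ) = 0 :=
  CliffordAlgebra.contractLeft_contractLeft d ψ

theorem ExteriorAlgebra.contractLeft_one (d : Module.Dual F W) :
    contractLeft d (1 : ExteriorAlgebra F W) = 0 :=
  CliffordAlgebra.contractLeft_one _ d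

theorem ExteriorAlgebra.ι_mul_swap (a b : W) : ι F a * ι F b = -(ι F b * ι F a) :=
  eq_neg_of_add_eq_zero_left (ExteriorAlgebra.ι_add_mul_swap a b)

/-- The Clifford relation for the spin representation. -/
theorem spinAction_spinAction (x y : W × Module.Dual F W) (ψ : ExteriorAlgebra F W) :
    spinAction F W x (spinAction F W y ψ) =
      -spinAction F W y (spinAction F W x ψ) + (x.2 y.1 + y.2 x.1) • ψ := by
  simp only [spinAction_apply, map_add, ExteriorAlgebra.contractLeft_ι_mul, ← mul_assoc]
  rw [ExteriorAlgebra.ι_mul_swap x.1 y.1, ExteriorAlgebra.contractLeft_comm x.2 y.2, add_smul,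
    neg_mul]
  abel

theorem spinAction_self (x : W × Module.Dual F W) (ψ : ExteriorAlgebra F W) :
    spinAction F W x (spinAction F W x ψ) = x.2 x.1 • ψ := by
  simp only [spinAction_apply, map_add, ExteriorAlgebra.contractLeft_ι_mul, ← mul_assoc]
  rw [ExteriorAlgebra.ι_sq_zero, ExteriorAlgebra.contractLeft_contractLeft, zero_mul]
  abel

theorem mem_spinorAnnihilator {x : W × Module.Dual F W} {ψ : ExteriorAlgebra F W} :
    x ∈ spinorAnnihilator ψ ↔ spinAction F W x ψ = 0 := Iff.rfl

/-- An injective operator that intertwines the spin action up to a linear automorphism of the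
quadratic space preserves purity. -/
theorem isPureSpinor_map_iff (G : ExteriorAlgebra F W →ₗ[F] ExteriorAlgebra F W) (hG : ∀ ψ, G ψ = 0 → ψ = 0)
    (τ : (W × Module.Dual F W) ≃ₗ[F] W × Module.Dual F W)
    (h : ∀ x ψ, spinAction F W x (G ψ) = G (spinAction F W (τ x) ψ)) (ψ : ExteriorAlgebra F W) :
    IsPureSpinor (G ψ) ↔ IsPureSpinor ψ := by
  have h1 : spinorAnnihilator (G ψ) = (spinorAnnihilator ψ).comap τ.toLinearMap := by
    ext x
    rw [Submodule.mem_comap, mem_spinorAnnihilator, mem_spinorAnnihilator, h]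
    exact ⟨fun h' => hG _ h', fun h' => by
      rw [LinearEquiv.coe_coe] at h'
      rw [h', map_zero]⟩
  have h2 : Module.finrank F (spinorAnnihilator (G ψ)) =
      Module.finrank F (spinorAnnihilator ψ) := by
    rw [h1, Submodule.comap_equiv_eq_map_symm]
    exact LinearEquiv.finrank_map_eq τ.symm _
  have h3 : G ψ = 0 ↔ ψ = 0 := ⟨hG ψ, fun h' => by rw [h', map_zero]⟩
  rw [IsPureSpinor, IsPureSpinor, h2, Ne, h3]

theorem spinAction_eq_zero_iff {x₀ : W × Module.Dual F W} (hx₀ : x₀.2 x₀.1 = 1) {ψ : ExteriorAlgebra F W} :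
    spinAction F W x₀ ψ = 0 ↔ ψ = 0 := by
  refine ⟨fun h => ?_, fun h => by rw [h, map_zero]⟩
  rw [← one_smul F ψ, ← hx₀, ← spinAction_self, h, map_zero]

/-- Vectors of norm `1` preserve purity. -/
theorem isPureSpinor_spinAction_iff {x₀ : W × Module.Dual F W} (hx₀ : x₀.2 x₀.1 = 1) (ψ : ExteriorAlgebra F W) :
    IsPureSpinor (spinAction F W x₀ ψ) ↔ IsPureSpinor ψ := by
  -- `τ` is minus the reflection in `x₀`; the Clifford relation with `x₀ ^ 2 = 1` turns `x x₀` into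
  -- `x₀ (τ x)`.
  let τ : (W × Module.Dual F W) →ₗ[F] W × Module.Dual F W :=
    { toFun := fun x => -x + (x.2 x₀.1 + x₀.2 x.1) • x₀
      map_add' := fun x y => by
        simp only [Prod.snd_add, Prod.fst_add, LinearMap.add_apply, map_add, add_smul]; abel
      map_smul' := fun c x => by
        simp only [Prod.smul_snd, Prod.smul_fst, LinearMap.smul_apply, map_smul, smul_eq_mul,
          RingHom.id_apply, smul_add, smul_neg, add_smul, mul_smul] }
  have hτ : ∀ x, τ x = -x + (x.2 x₀.1 + x₀.2 x.1) • x₀ := fun _ => rfl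
  have hinv : Function.Involutive τ := by
    intro x
    rw [hτ (τ x), hτ x]
    simp only [Prod.snd_add, Prod.fst_add, Prod.snd_neg, Prod.fst_neg, Prod.smul_snd, Prod.smul_fst,
      LinearMap.add_apply, LinearMap.neg_apply, LinearMap.smul_apply, map_add, map_neg, map_smul,
      smul_eq_mul, hx₀]
    rw [neg_add, neg_neg, add_assoc, add_eq_left, neg_add_eq_zero]
    congr 1
    ring
  refine isPureSpinor_map_iff _ (fun ψ => (spinAction_eq_zero_iff hx₀).mp)
    (LinearEquiv.ofInvolutive τ hinv) (fun x ψ => ?_) ψ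
  rw [LinearEquiv.coe_ofInvolutive, hτ, spinAction_spinAction, map_add (spinAction F W),
    LinearMap.add_apply, map_add, map_neg (spinAction F W), LinearMap.neg_apply, map_neg,
    map_smul (spinAction F W), LinearMap.smul_apply, map_smul, spinAction_self, hx₀, one_smul]

/-- The unipotent `1 + s a b`. -/
def oneAddWedge (s : F) (a b : W) : ExteriorAlgebra F W := 1 + s • (ι F a * ι F b)

theorem oneAddWedge_neg_mul (s : F) (a b : W) :
    oneAddWedge (-s) a b * oneAddWedge s a b = (1 : ExteriorAlgebra F W) := by
  have h : ι F a * ι F b * (ι F a * ι F b) = 0 := by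
    rw [mul_assoc, ← mul_assoc (ι F b), ExteriorAlgebra.ι_mul_swap b a, neg_mul, mul_assoc,
      ExteriorAlgebra.ι_sq_zero, mul_zero, neg_zero, mul_zero]
  simp only [oneAddWedge, mul_add, add_mul, mul_one, one_mul, smul_mul_assoc, mul_smul_comm, h,
    smul_zero, neg_smul, neg_mul, neg_zero, smul_add]
  abel

/-- The unipotents `1 + s a b` preserve purity. -/
theorem isPureSpinor_oneAddWedge_mul_iff (s : F) (a b : W) (ψ : ExteriorAlgebra F W) :
    IsPureSpinor (oneAddWedge s a b * ψ) ↔ IsPureSpinor ψ := by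
  -- Conjugation by the unipotent fixes `W` and shifts a functional `x.2` by its contraction with `s
  -- a ∧ b`.
  let τ : F → (W × Module.Dual F W) →ₗ[F] W × Module.Dual F W := fun s =>
    { toFun := fun x => (x.1 + s • (x.2 a • b - x.2 b • a), x.2)
      map_add' := fun x y => by
        ext
        · simp only [Prod.snd_add, Prod.fst_add, LinearMap.add_apply, smul_sub, add_smul, smul_add]
          abel
        · rfl
      map_smul' := fun c x => by
        ext
        · simp only [Prod.smul_snd, Prod.smul_fst, LinearMap.smul_apply, smul_eq_mul,
            RingHom.id_apply, smul_sub, smul_add, mul_smul, smul_comm s c]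
        · rfl }
  have hτ : ∀ s x, τ s x = (x.1 + s • (x.2 a • b - x.2 b • a), x.2) := fun _ _ => rfl
  have hinv : ∀ s x, τ (-s) (τ s x) = x := by
    intro s x
    rw [hτ, hτ]
    ext
    · simp only [neg_smul]; abel
    · rfl
  refine isPureSpinor_map_iff (LinearMap.mulLeft F (oneAddWedge s a b)) (fun ψ hψ => ?_)
    (LinearEquiv.ofLinearMap (τ s) (τ (-s))
      (LinearMap.ext fun x => by simpa using hinv (-s) x) (LinearMap.ext fun x => hinv s x))
    (fun x ψ => ?_) ψ
  · rw [LinearMap.mulLeft_apply] at hψ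
    rw [← one_mul ψ, ← oneAddWedge_neg_mul s a b, mul_assoc, hψ, mul_zero]
  · rw [LinearEquiv.coe_ofLinearMap, hτ]
    have hw : ∀ w, ι F w * (ι F a * ι F b) = ι F a * ι F b * ι F w := by
      intro w
      rw [← mul_assoc, ExteriorAlgebra.ι_mul_swap w a, neg_mul, mul_assoc,
        ExteriorAlgebra.ι_mul_swap w b, mul_neg, neg_neg, mul_assoc]
    have ha : ι F a * ι F b * ι F a = 0 := by
      rw [← hw, ← mul_assoc, ExteriorAlgebra.ι_sq_zero, zero_mul]
    have hb : ι F a * ι F b * ι F b = 0 := by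
      rw [mul_assoc, ExteriorAlgebra.ι_sq_zero, mul_zero]
    have hab : ∀ (t t' : F), oneAddWedge s a b * ι F (t • b - t' • a) = ι F (t • b - t' • a) := by
      intro t t'
      rw [oneAddWedge, add_mul, one_mul, smul_mul_assoc, map_sub, map_smul, map_smul, mul_sub,
        mul_smul_comm, mul_smul_comm, ha, hb]
      simp
    simp only [LinearMap.mulLeft_apply, spinAction_apply]
    rw [map_add (ExteriorAlgebra.ι F), add_mul, mul_add, mul_add, map_smul (ExteriorAlgebra.ι F),
      smul_mul_assoc, mul_smul_comm, ← mul_assoc _ (ι F (_ - _)), hab]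
    simp only [oneAddWedge, add_mul, mul_add, one_mul, smul_mul_assoc, map_add, map_smul,
      mul_smul_comm, mul_assoc, ExteriorAlgebra.contractLeft_ι_mul, mul_sub, map_sub, sub_mul]
    rw [← mul_assoc (ι F a) (ι F b) (ι F x.1 * ψ), ← mul_assoc (ι F a * ι F b), ← hw, mul_assoc,
      mul_assoc]
    simp only [smul_sub]
    abel

theorem isPureSpinor_smul_iff {c : F} (hc : c ≠ 0) (ψ : ExteriorAlgebra F W) :
    IsPureSpinor (c • ψ) ↔ IsPureSpinor ψ := by
  have h : spinorAnnihilator (c • ψ) = spinorAnnihilator ψ := by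
    ext x
    rw [mem_spinorAnnihilator, mem_spinorAnnihilator, map_smul, smul_eq_zero, or_iff_right hc]
  rw [IsPureSpinor, IsPureSpinor, h, Ne, smul_eq_zero, or_iff_right hc]

/-- The annihilator is the dual space: contractions kill scalars, and exterior multiplication by a
nonzero vector does not. -/
theorem isPureSpinor_one : IsPureSpinor (1 : ExteriorAlgebra F W) := by
  refine ⟨one_ne_zero, ?_⟩
  have h : spinorAnnihilator (1 : ExteriorAlgebra F W) = LinearMap.range (LinearMap.inr F W (Module.Dual F W)) := by
    ext x
    rw [mem_spinorAnnihilator, spinAction_apply, ExteriorAlgebra.contractLeft_one, mul_one, add_zero,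
      ExteriorAlgebra.ι_eq_zero_iff, LinearMap.mem_range]
    constructor
    · intro hx
      exact ⟨x.2, Prod.ext hx.symm rfl⟩
    · rintro ⟨f, rfl⟩
      rfl
  rw [h, LinearMap.finrank_range_of_inj LinearMap.inr_injective, Subspace.dual_finrank_eq]

/-- Nonzero spinors of the form `c + a w` are pure. -/
theorem isPureSpinor_add_wedge (c : F) (a w : W)
    (h : algebraMap F (ExteriorAlgebra F W) c + ι F a * ι F w ≠ 0) :
    IsPureSpinor (algebraMap F (ExteriorAlgebra F W) c + ι F a * ι F w) := by
  -- For `c = 0`, after moving `w` into the kernel of some `f` with `f a = 1`, the spinor arises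
  -- from `1` by two vectors of norm `1`. For `c ≠ 0` it is `c` times a unipotent applied to `1`.
  by_cases hc : c = 0
  · rw [hc, map_zero, zero_add] at h ⊢
    have ha : a ≠ 0 := by rintro rfl; simp at h
    obtain ⟨f, hf⟩ := Module.Projective.exists_dual_eq_one F ha
    set w' := w - f w • a with hw'
    have haw : ι F a * ι F w = ι F a * ι F w' := by
      rw [hw', map_sub, map_smul, mul_sub, mul_smul_comm, ExteriorAlgebra.ι_sq_zero, smul_zero,
        sub_zero]
    have hfw : f w' = 0 := by rw [hw', map_sub, map_smul, hf, smul_eq_mul, mul_one, sub_self]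
    have hw0 : w' ≠ 0 := by
      intro h0; rw [haw, h0, map_zero, mul_zero] at h; exact h rfl
    obtain ⟨g, hg⟩ := Module.Projective.exists_dual_eq_one F hw0
    have h1 : spinAction F W (w', g) (1 : ExteriorAlgebra F W) = ι F w' := by
      rw [spinAction_apply, ExteriorAlgebra.contractLeft_one, mul_one, add_zero]
    have h2 : spinAction F W (a, f) (ι F w') = ι F a * ι F w' := by
      rw [spinAction_apply]
      have : contractLeft f (ι F w') = (0 : ExteriorAlgebra F W) := by
        rw [← mul_one (ι F w'), ExteriorAlgebra.contractLeft_ι_mul, hfw,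
          ExteriorAlgebra.contractLeft_one]
        simp
      rw [this, add_zero]
    rw [haw, ← h2, isPureSpinor_spinAction_iff (x₀ := (a, f)) hf, ← h1,
      isPureSpinor_spinAction_iff (x₀ := (w', g)) hg]
    exact isPureSpinor_one
  · have : algebraMap F (ExteriorAlgebra F W) c + ι F a * ι F w = c • (oneAddWedge c⁻¹ a w * 1) := by
      rw [oneAddWedge, mul_one, smul_add, smul_smul, mul_inv_cancel₀ hc, one_smul,
        Algebra.algebraMap_eq_smul_one]
    rw [this, isPureSpinor_smul_iff hc, isPureSpinor_oneAddWedge_mul_iff]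
    exact isPureSpinor_one

theorem ι_mul_mem_evenOdd (a : W) (n : ZMod 2) {ψ : ExteriorAlgebra F W}
    (hψ : ψ ∈ CliffordAlgebra.evenOdd (0 : QuadraticForm F W) n) :
    ι F a * ψ ∈ CliffordAlgebra.evenOdd (0 : QuadraticForm F W) (n + 1) := by
  rw [add_comm]
  exact CliffordAlgebra.evenOdd_mul_le _ _ _
    (Submodule.mul_mem_mul (CliffordAlgebra.ι_mem_evenOdd_one _ a) hψ)

/-- Contractions change the parity. -/
theorem contractLeft_mem_evenOdd (d : Module.Dual F W) (n : ZMod 2) {ψ : ExteriorAlgebra F W}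
    (hψ : ψ ∈ CliffordAlgebra.evenOdd (0 : QuadraticForm F W) n) :
    contractLeft d ψ ∈ CliffordAlgebra.evenOdd (0 : QuadraticForm F W) (n + 1) := by
  have htwo : ∀ n : ZMod 2, n + 1 + 1 = n := by decide
  induction ψ, hψ using CliffordAlgebra.evenOdd_induction with
  | range_ι_pow v h =>
    fin_cases n
    · obtain ⟨r, rfl⟩ := Submodule.mem_one.mp h
      rw [CliffordAlgebra.contractLeft_algebraMap]
      exact Submodule.zero_mem _
    · obtain ⟨w, rfl⟩ := (pow_one (LinearMap.range (CliffordAlgebra.ι (0 : QuadraticForm F W)))) ▸ h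
      rw [CliffordAlgebra.contractLeft_ι]
      exact CliffordAlgebra.one_le_evenOdd_zero _ (Submodule.algebraMap_mem _)
  | add x y hx hy hx' hy' =>
    rw [map_add]
    exact Submodule.add_mem _ hx' hy'
  | ι_mul_ι_mul a b x hx hx' =>
    have hb : ι F b * x ∈ CliffordAlgebra.evenOdd (0 : QuadraticForm F W) (n + 1) :=
      ι_mul_mem_evenOdd b n hx
    have hb' := ι_mul_mem_evenOdd a _ (ι_mul_mem_evenOdd b _ hx')
    have ha := ι_mul_mem_evenOdd a _ (Submodule.smul_mem _ (d b) hx)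
    rw [htwo] at hb'
    have : contractLeft d (ι F a * ι F b * x) =
        d a • (ι F b * x) - (ι F a * (d b • x) - ι F a * (ι F b * contractLeft d x)) := by
      rw [mul_assoc, ExteriorAlgebra.contractLeft_ι_mul, ExteriorAlgebra.contractLeft_ι_mul, mul_sub]
    change contractLeft d (ι F a * ι F b * x) ∈ _
    rw [this]
    exact Submodule.sub_mem _ (Submodule.smul_mem _ _ hb) (Submodule.sub_mem _ ha hb')

theorem spinAction_mem_evenOdd (x : W × Module.Dual F W) (n : ZMod 2) {ψ : ExteriorAlgebra F W}
    (hψ : ψ ∈ CliffordAlgebra.evenOdd (0 : QuadraticForm F W) n) :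
    spinAction F W x ψ ∈ CliffordAlgebra.evenOdd (0 : QuadraticForm F W) (n + 1) :=
  Submodule.add_mem _ (ι_mul_mem_evenOdd x.1 n hψ) (contractLeft_mem_evenOdd x.2 n hψ)

theorem algebraMapInv_ι (w : W) : ExteriorAlgebra.algebraMapInv (ι F w) = 0 := by
  simp [ExteriorAlgebra.algebraMapInv]

theorem algebraMapInv_eq_zero_of_mem_odd {ψ : ExteriorAlgebra F W}
    (hψ : ψ ∈ CliffordAlgebra.evenOdd (0 : QuadraticForm F W) 1) :
    ExteriorAlgebra.algebraMapInv ψ = 0 := by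
  induction ψ, hψ using CliffordAlgebra.odd_induction with
  | ι v => exact algebraMapInv_ι v
  | add x y _ _ hx hy => rw [map_add, hx, hy, add_zero]
  | ι_mul_ι_mul a b x _ hx => rw [map_mul, hx, mul_zero]

end Spinors

/-! ### Components of spinors and the quadratic relations of pure spinors. -/

section SpinorCoordinates

open CliffordAlgebra (contractLeft)
open ExteriorAlgebra (ι algebraMapInv)

/-- Here `s`, `ab`, …, `cd` and `v` are the components of a spinor in degrees `0`, `2`, `4`. The `E`
and `T` equations are the degree `1` and `3` parts of its annihilation by a vector with coordinates
`wa`, …, `fd`. Suitable combinations multiply each coordinate by the defect `s * v - Pf`, so a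
nonzero annihilating vector kills the defect. -/
theorem spinor_quadric_aux {F : Type*} [Field F] {wa wb wc wd fa fb fc fd s v ab ac ad bc bd cd : F}
    (Ea : wa * s - fb * ab - fc * ac - fd * ad = 0)
    (Eb : wb * s + fa * ab - fc * bc - fd * bd = 0)
    (Ec : wc * s + fa * ac + fb * bc - fd * cd = 0)
    (Ed : wd * s + fa * ad + fb * bd + fc * cd = 0)
    (Ta : wb * cd - wc * bd + wd * bc + fa * v = 0)
    (Tb : wa * cd - wc * ad + wd * ac - fb * v = 0)
    (Tc : wa * bd - wb * ad + wd * ab + fc * v = 0)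
    (Td : wa * bc - wb * ac + wc * ab - fd * v = 0)
    (h : ¬(wa = 0 ∧ wb = 0 ∧ wc = 0 ∧ wd = 0 ∧ fa = 0 ∧ fb = 0 ∧ fc = 0 ∧ fd = 0)) :
    s * v = ab * cd - ac * bd + ad * bc := by
  by_contra hq
  have hq' : s * v - (ab * cd - ac * bd + ad * bc) ≠ 0 := sub_ne_zero.mpr hq
  refine h ⟨?_, ?_, ?_, ?_, ?_, ?_, ?_, ?_⟩ <;> refine (mul_eq_zero.mp ?_).resolve_left hq'
  · linear_combination v * Ea - ab * Tb + ac * Tc - ad * Td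
  · linear_combination v * Eb - ab * Ta + bc * Tc - bd * Td
  · linear_combination v * Ec - ac * Ta + bc * Tb - cd * Td
  · linear_combination v * Ed - ad * Ta + bd * Tb - cd * Tc
  · linear_combination s * Ta - cd * Eb + bd * Ec - bc * Ed
  · linear_combination -s * Tb + cd * Ea - ad * Ec + ac * Ed
  · linear_combination s * Tc - bd * Ea + ad * Eb - ab * Ed
  · linear_combination -s * Td + bc * Ea - ac * Eb + ab * Ec

variable {F W : Type*} [Field F] [AddCommGroup W] [Module F W]

/-- The part of degree `2` of a spinor, as a bilinear form on the dual space. -/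
noncomputable def spinorForm : ExteriorAlgebra F W →ₗ[F]
    Module.Dual F W →ₗ[F] Module.Dual F W →ₗ[F] F :=
  LinearMap.mk₂ F (fun ψ f => algebraMapInv.toLinearMap.comp
    ((contractLeft (Q := (0 : QuadraticForm F W))).flip (contractLeft f ψ)))
    (fun ψ ψ' f => by ext g; simp) (fun c ψ f => by ext g; simp)
    (fun ψ f f' => by ext g; simp) (fun c ψ f => by ext g; simp)

theorem spinorForm_apply (ψ : ExteriorAlgebra F W) (f g : Module.Dual F W) :
    spinorForm ψ f g = algebraMapInv (contractLeft g (contractLeft f ψ)) := rfl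

/-- The part of degree `4` of a spinor, as a form on the dual space. -/
noncomputable def spinorQuartic (a b c d : Module.Dual F W) : ExteriorAlgebra F W →ₗ[F] F :=
  algebraMapInv.toLinearMap.comp ((contractLeft d).comp ((contractLeft c).comp
    ((contractLeft b).comp (contractLeft (Q := (0 : QuadraticForm F W)) a))))

theorem spinorQuartic_apply (a b c d : Module.Dual F W) (ψ : ExteriorAlgebra F W) :
    spinorQuartic a b c d ψ =
      algebraMapInv (contractLeft d (contractLeft c (contractLeft b (contractLeft a ψ)))) := rfl

theorem spinorForm_self (ψ : ExteriorAlgebra F W) (f : Module.Dual F W) : spinorForm ψ f f = 0 := by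
  rw [spinorForm_apply, ExteriorAlgebra.contractLeft_contractLeft, map_zero]

theorem algebraMapInv_ι_mul (w : W) (ψ : ExteriorAlgebra F W) : algebraMapInv (ι F w * ψ) = 0 := by
  rw [map_mul, algebraMapInv_ι, zero_mul]

theorem exists_mem_ker_of_two_lt_finrank {N P : Type*} [AddCommGroup N] [Module F N]
    [AddCommGroup P] [Module F P] (S : Submodule F (N × P)) (hS : 2 < Module.finrank F S)
    (g : N →ₗ[F] F) (k : P →ₗ[F] F) :
    ∃ w f, (w, f) ∈ S ∧ g w = 0 ∧ k f = 0 ∧ ¬(w = 0 ∧ f = 0) := by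
  have hlt : Module.finrank F (F × F) < Module.finrank F S := by
    rwa [Module.finrank_prod, Module.finrank_self]
  have : FiniteDimensional F S := Module.finite_of_finrank_pos (by omega)
  obtain ⟨⟨⟨w, f⟩, hx⟩, hk, h0⟩ := (Submodule.ne_bot_iff _).mp
    (LinearMap.ker_ne_bot_of_finrank_lt (f := (g.prodMap k).comp S.subtype) hlt)
  exact ⟨w, f, hx, congrArg Prod.fst hk, congrArg Prod.snd hk,
    fun h => h0 (Subtype.ext (Prod.ext h.1 h.2))⟩

/-- The vectors annihilating a pure spinor on a `5`-dimensional space supply a nontrivial solution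
of the equations used to compare its components. -/
theorem exists_annihilating_coefficients (hW : Module.finrank F W = 5) {ψ : ExteriorAlgebra F W}
    (hψ : IsPureSpinor ψ) (h : Fin 4 → Module.Dual F W) :
    ∃ (w : W) (c : Fin 4 → F), spinAction F W (w, ∑ i, c i • h i) ψ = 0 ∧
      ¬((∀ i, h i w = 0) ∧ ∀ i, c i = 0) := by
  have hfd : FiniteDimensional F W := Module.finite_of_finrank_pos (by omega)
  -- If independent, the `h i` span the functionals vanishing on a line `⟨e₀⟩`. Of the two
  -- conditions imposed on the `5`-dimensional annihilator, `f e₀ = 0` puts `f` in that span, and `g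
  -- w = 0` with `g e₀ = 1` ensures that a nonzero `w` is detected by the `h i`. If dependent, a
  -- linear relation with `w = 0` serves.
  by_cases hli : LinearIndependent F h
  · set Φ := Submodule.span F (Set.range h) with hΦ
    have h4 : Module.finrank F Φ = 4 := by
      rw [hΦ, finrank_span_eq_card hli, Fintype.card_fin]
    have hΦfd : FiniteDimensional F Φ := FiniteDimensional.finiteDimensional_submodule Φ
    have h1 : Module.finrank F Φ.dualCoannihilator = 1 := by
      have := Subspace.finrank_add_finrank_dualCoannihilator_eq (K := F) (V := W) Φ
      omega
    obtain ⟨⟨e₀, he₀⟩, hne, hspan⟩ := finrank_eq_one_iff'.mp h1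
    have hne' : e₀ ≠ 0 := fun h => hne (Subtype.ext h)
    obtain ⟨g, hg⟩ := Module.Projective.exists_dual_eq_one F hne'
    obtain ⟨w, f, hx, hw, hf, hx0⟩ := exists_mem_ker_of_two_lt_finrank (spinorAnnihilator ψ)
      (by rw [hψ.2, hW]; omega) g (Module.Dual.eval F W e₀)
    rw [Module.Dual.eval_apply] at hf
    have hfΦ : f ∈ Φ := by
      rw [← Subspace.dualCoannihilator_dualAnnihilator_eq (K := F) (V := W) (W := Φ), Submodule.mem_dualAnnihilator]
      intro u hu
      obtain ⟨t, ht⟩ := hspan ⟨u, hu⟩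
      have : t • e₀ = u := congrArg Subtype.val ht
      rw [← this, map_smul, hf, smul_zero]
    obtain ⟨c, hc⟩ := (Submodule.mem_span_range_iff_exists_fun F).mp hfΦ
    refine ⟨w, c, hc ▸ hx, ?_⟩
    rintro ⟨hw', hc'⟩
    have hf0 : f = 0 := by rw [← hc]; simp [hc']
    have hwΦ : w ∈ Φ.dualCoannihilator := by
      rw [Submodule.mem_dualCoannihilator]
      intro φ hφ
      obtain ⟨c, rfl⟩ := (Submodule.mem_span_range_iff_exists_fun F).mp hφ
      simp [hw']
    obtain ⟨t, ht⟩ := hspan ⟨w, hwΦ⟩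
    have ht' : t • e₀ = w := congrArg Subtype.val ht
    have ht0 : t = 0 := by
      rw [← ht', map_smul, hg, smul_eq_mul, mul_one] at hw
      exact hw
    have hw0 : w = 0 := by rw [← ht', ht0, zero_smul]
    exact hx0 ⟨hw0, hf0⟩
  · obtain ⟨c, hc, i, hi⟩ := Fintype.not_linearIndependent_iff.mp hli
    refine ⟨0, c, ?_, fun h => hi (h.2 i)⟩
    rw [hc]
    exact LinearMap.map_zero₂ _ _

/-- The quadratic relations between the components of a pure spinor. -/
theorem IsPureSpinor.mul_spinorQuartic (hW : Module.finrank F W = 5) {ψ : ExteriorAlgebra F W}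
    (hψ : IsPureSpinor ψ) (a b c d : Module.Dual F W) :
    algebraMapInv ψ * spinorQuartic a b c d ψ = gramPfaffian (spinorForm ψ) a b c d := by
  obtain ⟨w, t, hx, hnz⟩ := exists_annihilating_coefficients hW hψ ![a, b, c, d]
  rw [spinAction_apply] at hx
  simp only [Fin.sum_univ_four, Matrix.cons_val, Fin.forall_fin_succ, map_add, map_smul,
    LinearMap.add_apply, LinearMap.smul_apply] at hx hnz
  have hB := neg_swap_of_alternating (spinorForm ψ) (spinorForm_self ψ)
  -- `hE` and `hT` read off the components of degrees `1` and `3` of the annihilation equation.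
  have hE : ∀ j : Module.Dual F W, j w * algebraMapInv ψ + t 0 * spinorForm ψ a j +
      t 1 * spinorForm ψ b j + t 2 * spinorForm ψ c j + t 3 * spinorForm ψ d j = 0 := by
    intro j
    have := congrArg (fun ψ => algebraMapInv (contractLeft j ψ)) hx
    simp only [map_add, map_smul, ExteriorAlgebra.contractLeft_ι_mul, map_sub, map_zero,
      algebraMapInv_ι_mul, smul_eq_mul] at this
    simp only [spinorForm_apply]
    linear_combination this
  have hT : ∀ j k l : Module.Dual F W, j w * spinorForm ψ k l - k w * spinorForm ψ j l +
      l w * spinorForm ψ j k + t 0 * spinorQuartic a j k l ψ + t 1 * spinorQuartic b j k l ψ +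
      t 2 * spinorQuartic c j k l ψ + t 3 * spinorQuartic d j k l ψ = 0 := by
    intro j k l
    have := congrArg (fun ψ => algebraMapInv (contractLeft l (contractLeft k (contractLeft j ψ)))) hx
    simp only [map_add, map_smul, ExteriorAlgebra.contractLeft_ι_mul, map_sub, map_zero,
      algebraMapInv_ι_mul, smul_eq_mul] at this
    simp only [spinorForm_apply, spinorQuartic_apply]
    linear_combination this
  have s12 : ∀ a b c d, spinorQuartic b a c d ψ = -spinorQuartic a b c d ψ := by
    intro a b c d
    simp only [spinorQuartic_apply]
    rw [ExteriorAlgebra.contractLeft_comm a b]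
    simp only [map_neg]
  have s23 : ∀ a b c d, spinorQuartic a c b d ψ = -spinorQuartic a b c d ψ := by
    intro a b c d
    simp only [spinorQuartic_apply]
    rw [ExteriorAlgebra.contractLeft_comm b c]
    simp only [map_neg]
  have s34 : ∀ a b c d, spinorQuartic a b d c ψ = -spinorQuartic a b c d ψ := by
    intro a b c d
    simp only [spinorQuartic_apply]
    rw [ExteriorAlgebra.contractLeft_comm c d]
    simp only [map_neg]
  have z : ∀ a c d, spinorQuartic a a c d ψ = 0 := by
    intro a c d
    simp only [spinorQuartic_apply, ExteriorAlgebra.contractLeft_contractLeft, map_zero]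
  have z13 : ∀ a b d, spinorQuartic a b a d ψ = 0 := fun a b d => by rw [s23, z, neg_zero]
  have z14 : ∀ a b c, spinorQuartic a b c a ψ = 0 := fun a b d => by rw [s34, z13, neg_zero]
  have Ea := hE a
  have Eb := hE b
  have Ec := hE c
  have Ed := hE d
  have Ta := hT b c d
  have Tb := hT a c d
  have Tc := hT a b d
  have Td := hT a b c
  simp only [z, z13, z14, spinorForm_self, mul_zero, add_zero] at Ea Eb Ec Ed Ta Tb Tc Td
  have q1 : spinorQuartic b a c d ψ = -spinorQuartic a b c d ψ := s12 a b c d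
  have q2 : spinorQuartic c a b d ψ = spinorQuartic a b c d ψ := by rw [s12 a c, s23 a b, neg_neg]
  have q3 : spinorQuartic d a b c ψ = -spinorQuartic a b c d ψ := by
    rw [s12 a d, s23 a b d, s34 a b c, neg_neg]
  rw [q1] at Tb
  rw [q2] at Tc
  rw [q3] at Td
  rw [hB a b] at Ea
  rw [hB a c] at Ea
  rw [hB a d] at Ea
  rw [hB b c, hB b d] at Eb
  rw [hB c d] at Ec
  exact spinor_quadric_aux (wa := a w) (wb := b w) (wc := c w) (wd := d w) (fa := t 0) (fb := t 1)
    (fc := t 2) (fd := t 3) (by linear_combination Ea) (by linear_combination Eb)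
    (by linear_combination Ec) (by linear_combination Ed) (by linear_combination Ta)
    (by linear_combination Tb) (by linear_combination Tc) (by linear_combination Td) (by
      intro hz
      apply hnz
      simpa [Fin.forall_fin_succ, and_assoc] using hz)

end SpinorCoordinates

/-! ### Coordinate contractions and reflections. -/

section SpinorBasis

open CliffordAlgebra (contractLeft)
open ExteriorAlgebra (ι algebraMapInv)

variable {F : Type*} [Field F]

/-- Killing the direction `e`, along a functional `f`, in the exterior algebra. -/
theorem map_id_sub_smulRight {W : Type*} [AddCommGroup W] [Module F W] (e : W)
    (f : Module.Dual F W) (ψ : ExteriorAlgebra F W) :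
    ExteriorAlgebra.map (LinearMap.id - f.smulRight e) ψ = ψ - ι F e * contractLeft f ψ := by
  induction ψ using CliffordAlgebra.left_induction with
  | algebraMap r =>
    rw [AlgHom.commutes, CliffordAlgebra.contractLeft_algebraMap, mul_zero, sub_zero]
  | add x y hx hy => rw [map_add, hx, hy, map_add, mul_add]; abel
  | ι_mul x m hx =>
    change ExteriorAlgebra.map _ (ι F m * x) = ι F m * x - ι F e * contractLeft f (ι F m * x)
    rw [map_mul, ExteriorAlgebra.map_apply_ι, hx, ExteriorAlgebra.contractLeft_ι_mul]
    simp only [LinearMap.sub_apply, LinearMap.id_apply, LinearMap.smulRight_apply, map_sub, map_smul,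
      mul_sub, sub_mul, smul_mul_assoc, mul_smul_comm]
    rw [← mul_assoc (ι F e) (ι F e), ExteriorAlgebra.ι_sq_zero, zero_mul, smul_zero,
      ← mul_assoc (ι F m) (ι F e), ExteriorAlgebra.ι_mul_swap m e, neg_mul, mul_assoc]
    abel

/-- Contraction with a coordinate functional. -/
noncomputable def contractCoord (j : Fin 5) : Module.End F (ExteriorAlgebra F (Fin 5 → F)) :=
  contractLeft (Q := (0 : QuadraticForm F (Fin 5 → F))) (LinearMap.proj j : Module.Dual F (Fin 5 → F))

/-- Clifford multiplication by the vector `e_j + e_j^*` of norm `1`. -/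
noncomputable def reflectCoord (j : Fin 5) : Module.End F (ExteriorAlgebra F (Fin 5 → F)) :=
  spinAction F (Fin 5 → F) (Pi.single j 1, LinearMap.proj j)

theorem contractCoord_apply (j : Fin 5) (ψ : ExteriorAlgebra F (Fin 5 → F)) :
    contractCoord j ψ = contractLeft (LinearMap.proj j : Module.Dual F (Fin 5 → F)) ψ := rfl

theorem reflectCoord_apply (j : Fin 5) (ψ : ExteriorAlgebra F (Fin 5 → F)) :
    reflectCoord j ψ = ι F (Pi.single j 1 : Fin 5 → F) * ψ + contractCoord j ψ := rfl

theorem contractCoord_comm (j k : Fin 5) (ψ : ExteriorAlgebra F (Fin 5 → F)) :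
    contractCoord j (contractCoord k ψ) = -contractCoord k (contractCoord j ψ) :=
  ExteriorAlgebra.contractLeft_comm _ _ _

theorem contractCoord_contractCoord (j : Fin 5) (ψ : ExteriorAlgebra F (Fin 5 → F)) :
    contractCoord j (contractCoord j ψ) = 0 :=
  ExteriorAlgebra.contractLeft_contractLeft _ _

/-- A spinor with zero contractions is a scalar. -/
theorem eq_algebraMap_of_contractCoord_eq_zero {ψ : ExteriorAlgebra F (Fin 5 → F)}
    (h : ∀ j, contractCoord j ψ = 0) : ψ = algebraMap F _ (algebraMapInv ψ) := by
  have hp : ∀ j : Fin 5, ExteriorAlgebra.map (LinearMap.id -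
      (LinearMap.proj j : Module.Dual F (Fin 5 → F)).smulRight (Pi.single j 1 : Fin 5 → F)) ψ =
        ψ := by
    intro j
    rw [map_id_sub_smulRight, ← contractCoord_apply, h, mul_zero, sub_zero]
  set p : Fin 5 → ((Fin 5 → F) →ₗ[F] (Fin 5 → F)) := fun j => LinearMap.id -
      (LinearMap.proj j : Module.Dual F (Fin 5 → F)).smulRight (Pi.single j 1 : Fin 5 → F) with hpdef
  -- Killing all five coordinates in turn is the zero map of the vector space, which induces the
  -- projection to scalars on the exterior algebra.
  have hcomp : (p 0).comp ((p 1).comp ((p 2).comp ((p 3).comp (p 4)))) = 0 := by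
    refine LinearMap.ext fun w => ?_
    ext i
    fin_cases i <;> simp [hpdef]
  have h0 : ExteriorAlgebra.map (0 : (Fin 5 → F) →ₗ[F] (Fin 5 → F)) ψ = ψ := by
    rw [← hcomp]
    simp only [← ExteriorAlgebra.map_comp_map, AlgHom.comp_apply]
    rw [hp 4, hp 3, hp 2, hp 1, hp 0]
  have h1 : ExteriorAlgebra.map (0 : (Fin 5 → F) →ₗ[F] (Fin 5 → F)) =
      (Algebra.ofId F _).comp algebraMapInv := by
    refine ExteriorAlgebra.hom_ext (LinearMap.ext fun w => ?_)
    simp [algebraMapInv_ι]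
  rw [h1] at h0
  exact h0.symm

/-- The scalar parts of the iterated contractions determine a spinor. -/
theorem eq_zero_of_contractCoord_list (k : ℕ) (ψ : ExteriorAlgebra F (Fin 5 → F))
    (hk : ∀ j : Fin 5, k ≤ j → contractCoord j ψ = 0)
    (h : ∀ l : List (Fin 5), l.Nodup → (∀ j ∈ l, (j : ℕ) < k) →
      algebraMapInv ((l.map contractCoord).prod ψ) = 0) : ψ = 0 := by
  induction k generalizing ψ with
  | zero =>
    have h0 := h [] List.nodup_nil (by simp)
    simp only [List.map_nil, List.prod_nil, Module.End.one_apply] at h0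
    rw [eq_algebraMap_of_contractCoord_eq_zero fun j => hk j (Nat.zero_le _), h0, map_zero]
  | succ k ih =>
    -- The contraction of `ψ` along coordinate `k` is itself killed by that coordinate, so the
    -- induction hypothesis makes it vanish; then the hypothesis applies to `ψ`.
    refine ih ψ (fun j hj => ?_) fun l hl hlk => h l hl fun j hj => (hlk j hj).trans (by omega)
    rcases Nat.lt_or_ge k j with hkj | hkj
    · exact hk j hkj
    · have hjk : (j : ℕ) = k := le_antisymm hkj hj
      refine ih (contractCoord j ψ) (fun i hi => ?_) fun l hl hlk => ?_
      · rcases Nat.lt_or_ge k i with hki | hki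
        · rw [contractCoord_comm, hk i hki, map_zero, neg_zero]
        · rw [show i = j from Fin.ext (by omega), contractCoord_contractCoord]
      · have := h (l ++ [j]) ?_ ?_
        · simpa [List.prod_append] using this
        · rw [List.nodup_append]
          refine ⟨hl, List.nodup_singleton j, fun i hi i' hi' => ?_⟩
          rw [List.mem_singleton.mp hi']
          rintro rfl
          exact absurd (hlk i hi) (by omega)
        · intro i hi
          rcases List.mem_append.mp hi with hi | hi
          · exact (hlk i hi).trans (by omega)
          · rw [List.mem_singleton.mp hi]; omega

theorem list_prod_mem_evenOdd (D : Fin 5 → Module.End F (ExteriorAlgebra F (Fin 5 → F)))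
    (hD : ∀ j (n : ZMod 2) ψ, ψ ∈ CliffordAlgebra.evenOdd (0 : QuadraticForm F (Fin 5 → F)) n →
      D j ψ ∈ CliffordAlgebra.evenOdd (0 : QuadraticForm F (Fin 5 → F)) (n + 1))
    {ψ : ExteriorAlgebra F (Fin 5 → F)} (hψ : ψ ∈ HalfSpinModule 5 F) (l : List (Fin 5)) :
    (l.map D).prod ψ ∈ CliffordAlgebra.evenOdd (0 : QuadraticForm F (Fin 5 → F)) (l.length : ℕ) := by
  induction l with
  | nil => simpa using hψ
  | cons j l ih =>
    rw [List.map_cons, List.prod_cons, Module.End.mul_apply, List.length_cons, Nat.cast_add,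
      Nat.cast_one]
    exact hD j _ _ ih

/-- A nonzero even spinor has a nonzero component. -/
theorem exists_contractCoord_ne_zero {ψ : ExteriorAlgebra F (Fin 5 → F)}
    (hψ : ψ ∈ HalfSpinModule 5 F) (h0 : ψ ≠ 0) : ∃ l : List (Fin 5), l.Nodup ∧ Even l.length ∧
      algebraMapInv ((l.map contractCoord).prod ψ) ≠ 0 := by
  by_contra! h
  refine h0 (eq_zero_of_contractCoord_list 5 ψ (fun j hj => absurd j.2 (by omega)) fun l hl _ => ?_)
  rcases Nat.even_or_odd l.length with he | ho
  · exact h l hl he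
  · refine algebraMapInv_eq_zero_of_mem_odd ?_
    have := list_prod_mem_evenOdd contractCoord (fun j n ψ => contractLeft_mem_evenOdd _ n) hψ l
    rwa [ZMod.natCast_eq_one_iff_odd.mpr ho] at this

/-- The components of degrees `0`, `2` and `4` determine an even spinor. -/
theorem eq_zero_of_components {ψ : ExteriorAlgebra F (Fin 5 → F)} (hψ : ψ ∈ HalfSpinModule 5 F)
    (h0 : algebraMapInv ψ = 0) (h2 : spinorForm ψ = 0) (h4 : ∀ a b c d, spinorQuartic a b c d ψ = 0) :
    ψ = 0 := by
  by_contra hne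
  obtain ⟨l, hl, he, hlne⟩ := exists_contractCoord_ne_zero hψ hne
  have hlen : l.length ≤ 5 := by simpa using hl.length_le_card
  refine hlne ?_
  match l, he, hlen with
  | [], _, _ => exact h0
  | [j, k], _, _ => exact LinearMap.congr_fun₂ h2 (LinearMap.proj k) (LinearMap.proj j)
  | [i, j, k, m], _, _ =>
    exact h4 (LinearMap.proj m) (LinearMap.proj k) (LinearMap.proj j) (LinearMap.proj i)
  | [_], he, _ => simp at he
  | [_, _, _], he, _ => exact absurd he (by simp; decide)
  | [_, _, _, _, _], he, _ => exact absurd he (by simp; decide)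
  | _ :: _ :: _ :: _ :: _ :: _ :: _, _, hlen => simp at hlen; omega

theorem contractCoord_reflectCoord {j k : Fin 5} (hjk : j ≠ k) (ψ : ExteriorAlgebra F (Fin 5 → F)) :
    contractCoord j (reflectCoord k ψ) = -reflectCoord k (contractCoord j ψ) := by
  rw [reflectCoord_apply, reflectCoord_apply, map_add, contractCoord_comm j k, contractCoord_apply,
    ExteriorAlgebra.contractLeft_ι_mul, LinearMap.proj_apply, Pi.single_eq_of_ne hjk, zero_smul,
    ← contractCoord_apply]
  abel

/-- The reflections move a component of a spinor to the scalar part. -/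
theorem algebraMapInv_reflectCoord_list (l : List (Fin 5)) (hl : l.Nodup)
    (ψ : ExteriorAlgebra F (Fin 5 → F))
    (h : algebraMapInv ((l.map reflectCoord).prod ψ) = 0) :
    algebraMapInv ((l.reverse.map contractCoord).prod ψ) = 0 := by
  induction l generalizing ψ with
  | nil => simpa using h
  | cons k l ih =>
    rw [List.nodup_cons] at hl
    -- The scalar part of `reflectCoord k` is that of `contractCoord k`, which passes the other
    -- reflections up to sign and so acts on `ψ` first. Hence the reversed list.
    have hcomm : ∀ l : List (Fin 5), k ∉ l →
        contractCoord k ((l.map reflectCoord).prod ψ) = (l.map reflectCoord).prod (contractCoord k ψ) ∨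
        contractCoord k ((l.map reflectCoord).prod ψ) =
          -(l.map reflectCoord).prod (contractCoord k ψ) := by
      intro l hkl
      induction l with
      | nil => left; rfl
      | cons m l ih' =>
        rw [List.mem_cons, not_or] at hkl
        simp only [List.map_cons, List.prod_cons, Module.End.mul_apply,
          contractCoord_reflectCoord hkl.1]
        rcases ih' hkl.2 with h | h
        · right; rw [h]
        · left; rw [h, map_neg, neg_neg]
    rw [List.reverse_cons, List.map_append, List.prod_append, List.map_singleton,
      List.prod_singleton, Module.End.mul_apply]
    refine ih hl.2 _ ?_
    rw [List.map_cons, List.prod_cons, Module.End.mul_apply, reflectCoord_apply, map_add,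
      algebraMapInv_ι_mul, zero_add] at h
    rcases hcomm l hl.1 with h' | h'
    · rwa [h'] at h
    · rwa [h', map_neg, neg_eq_zero] at h

theorem reflectCoord_norm (j : Fin 5) :
    (LinearMap.proj j : Module.Dual F (Fin 5 → F)) (Pi.single j 1) = 1 := by
  simp

theorem isPureSpinor_reflectCoord_list_iff (l : List (Fin 5)) (ψ : ExteriorAlgebra F (Fin 5 → F)) :
    IsPureSpinor ((l.map reflectCoord).prod ψ) ↔ IsPureSpinor ψ := by
  induction l with
  | nil => rfl
  | cons j l ih =>
    rw [← ih, List.map_cons, List.prod_cons, Module.End.mul_apply]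
    exact isPureSpinor_spinAction_iff (reflectCoord_norm j) _

theorem reflectCoord_list_injective (l : List (Fin 5)) :
    Function.Injective (l.map (reflectCoord (F := F))).prod := by
  refine (injective_iff_map_eq_zero _).mpr fun ψ h => ?_
  induction l with
  | nil => simpa using h
  | cons j l ih =>
    rw [List.map_cons, List.prod_cons, Module.End.mul_apply] at h
    exact ih ((spinAction_eq_zero_iff (reflectCoord_norm j)).mp h)

end SpinorBasis

/-! ### The affine half-spin graph. -/

section AffineHalfSpin

open CliffordAlgebra (contractLeft)
open ExteriorAlgebra (ι algebraMapInv)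

variable {F : Type*} [Field F]

theorem card_le_pow_four_of_forms [Finite F] {V : Type*} [AddCommGroup V] [Module F V]
    [FiniteDimensional F V] (hV : Module.finrank F V = 5) (C : Finset (V →ₗ[F] V →ₗ[F] F))
    (halt : ∀ B ∈ C, ∀ x, B x x = 0)
    (hpf : ∀ A ∈ C, ∀ B ∈ C, ∀ a b c d, gramPfaffian (A - B) a b c d = 0) :
    C.card ≤ Nat.card F ^ 4 :=
  card_le_pow_four_of_gramPfaffian_sub_eq_zero LinearMap.id hV (fun _ h => h) C halt hpf

/-- A set of even spinors in dimension `5`, with pairwise differences zero or pure, that contains `0`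
and a spinor with nonzero scalar part has at most `q ^ 5` elements. -/
theorem card_le_pow_five_of_pure_differences [Finite F]
    (C : Finset (ExteriorAlgebra F (Fin 5 → F))) (heven : ∀ x ∈ C, x ∈ HalfSpinModule 5 F)
    (h0 : 0 ∈ C) {u : ExteriorAlgebra F (Fin 5 → F)} (hu : u ∈ C) (hu0 : algebraMapInv u ≠ 0)
    (hpure : ∀ x ∈ C, ∀ y ∈ C, x ≠ y → IsPureSpinor (x - y)) : C.card ≤ Nat.card F ^ 5 := by
  classical
  have := Fintype.ofFinite F
  have hW : Module.finrank F (Fin 5 → F) = 5 := Module.finrank_fin_fun F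
  have hquad : ∀ x ∈ C, ∀ y ∈ C, ∀ a b c d, algebraMapInv (x - y) * spinorQuartic a b c d (x - y) =
      gramPfaffian (spinorForm (x - y)) a b c d := by
    intro x hx y hy a b c d
    by_cases hxy : x = y
    · simp [hxy, gramPfaffian]
    · exact (hpure x hx y hy hxy).mul_spinorQuartic hW a b c d
  have hpolar : ∀ x ∈ C, ∀ a b c d, algebraMapInv u * spinorQuartic a b c d x +
      algebraMapInv x * spinorQuartic a b c d u =
      spinorForm u a b * spinorForm x c d + spinorForm x a b * spinorForm u c d -
      spinorForm u a c * spinorForm x b d - spinorForm x a c * spinorForm u b d +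
      spinorForm u a d * spinorForm x b c + spinorForm x a d * spinorForm u b c := by
    intro x hx a b c d
    have h1 := hquad x hx 0 h0 a b c d
    have h2 := hquad u hu 0 h0 a b c d
    have h3 := hquad x hx u hu a b c d
    simp only [sub_zero, map_sub, gramPfaffian, LinearMap.sub_apply] at h1 h2 h3
    linear_combination h1 + h2 - h3
  -- Projection from `u`: the degree `2` part of the combination of `x` and `u` whose scalar part
  -- cancels.
  let p : ExteriorAlgebra F (Fin 5 → F) →
      Module.Dual F (Fin 5 → F) →ₗ[F] Module.Dual F (Fin 5 → F) →ₗ[F] F := fun x =>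
    algebraMapInv u • spinorForm x - algebraMapInv x • spinorForm u
  have hp : ∀ x a b, p x a b = algebraMapInv u * spinorForm x a b -
      algebraMapInv x * spinorForm u a b := fun _ _ _ => rfl
  -- The quadratic relations hold at `x - y` and at `u` and, by `hpolar`, their polar forms vanish
  -- on the pair. They hold on the span, and with zero scalar part they say that the Pfaffians
  -- vanish.
  have hpcard : (C.image p).card ≤ Nat.card F ^ 4 := by
    refine card_le_pow_four_of_forms (by rw [Subspace.dual_finrank_eq, hW]) _ ?_ ?_
    · intro B hB a
      obtain ⟨x, -, rfl⟩ := Finset.mem_image.mp hB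
      rw [hp, spinorForm_self, spinorForm_self, mul_zero, mul_zero, sub_zero]
    · intro A hA B hB a b c d
      obtain ⟨x, hx, rfl⟩ := Finset.mem_image.mp hA
      obtain ⟨y, hy, rfl⟩ := Finset.mem_image.mp hB
      have h1 := hpolar x hx a b c d
      have h2 := hpolar y hy a b c d
      have h3 := hquad x hx y hy a b c d
      have h4 := hquad u hu 0 h0 a b c d
      simp only [sub_zero, map_sub, gramPfaffian, LinearMap.sub_apply, hp] at h1 h2 h3 h4 ⊢
      linear_combination -algebraMapInv u ^ 2 * h3 + algebraMapInv u *
        (algebraMapInv x - algebraMapInv y) * (h1 - h2) -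
        (algebraMapInv x - algebraMapInv y) ^ 2 * h4
  -- With degrees `0` and `2` known, `hpolar` determines the degree `4` part, because `u` has
  -- nonzero scalar part.
  have hinj : Set.InjOn (fun x => (algebraMapInv x, p x)) (C : Set (ExteriorAlgebra F (Fin 5 → F))) := by
    intro x hx y hy hxy
    have h1 : algebraMapInv x = algebraMapInv y := congrArg Prod.fst hxy
    have h2 : p x = p y := congrArg Prod.snd hxy
    have hB : ∀ a b, spinorForm x a b = spinorForm y a b := by
      intro a b
      have := LinearMap.congr_fun₂ h2 a b
      rw [hp, hp, h1] at this
      exact mul_left_cancel₀ hu0 (sub_left_injective this)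
    refine sub_eq_zero.mp (eq_zero_of_components
      (Submodule.sub_mem _ (heven x hx) (heven y hy)) ?_ ?_ ?_)
    · rw [map_sub, h1, sub_self]
    · exact LinearMap.ext₂ fun a b => by
        rw [map_sub, LinearMap.sub_apply, LinearMap.sub_apply, hB, sub_self]; rfl
    · intro a b c d
      have h3 := hpolar x hx a b c d
      have h4 := hpolar y hy a b c d
      simp only [hB, h1] at h3 h4
      rw [map_sub, sub_eq_zero]
      refine mul_left_cancel₀ hu0 ?_
      linear_combination h3 - h4
  have hsub : C.image (fun x => (algebraMapInv x, p x)) ⊆ Finset.univ ×ˢ C.image p := by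
    intro z hz
    obtain ⟨x, hx, rfl⟩ := Finset.mem_image.mp hz
    exact Finset.mem_product.mpr ⟨Finset.mem_univ _, Finset.mem_image_of_mem p hx⟩
  rw [← Finset.card_image_of_injOn hinj]
  refine (Finset.card_le_card hsub).trans ?_
  rw [Finset.card_product, Finset.card_univ, ← Nat.card_eq_fintype_card, pow_succ' _ 4]
  exact Nat.mul_le_mul_left _ hpcard

/-- Cliques of the affine half-spin graph have at most `q ^ 5` elements. -/
theorem card_le_pow_five_of_isClique_affineHalfSpinGraph [Finite F]
    (s : Finset (HalfSpinModule 5 F)) (hs : (affineHalfSpinGraph F).IsClique s) :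
    s.card ≤ Nat.card F ^ 5 := by
  classical
  by_cases hs1 : s.card ≤ 1
  · exact hs1.trans (Nat.pow_pos Nat.card_pos)
  obtain ⟨a, ha, b, hb, hab⟩ := Finset.one_lt_card.mp (not_le.mp hs1)
  have hba : ((b - a : HalfSpinModule 5 F) : ExteriorAlgebra F (Fin 5 → F)) ≠ 0 := by
    rw [Ne, ZeroMemClass.coe_eq_zero, sub_eq_zero]
    exact hab.symm
  -- With `a` moved to `0`, reflections along a nonzero component of `b - a` make its scalar part
  -- nonzero. Their number is even, so they keep the half-spin module.
  obtain ⟨l, hl, he, hlne⟩ := exists_contractCoord_ne_zero (b - a).2 hba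
  set R := (l.reverse.map (reflectCoord (F := F))).prod with hR
  have hRinj : Function.Injective R := reflectCoord_list_injective _
  have hRpure : ∀ ψ, IsPureSpinor (R ψ) ↔ IsPureSpinor ψ := isPureSpinor_reflectCoord_list_iff _
  let f : HalfSpinModule 5 F → ExteriorAlgebra F (Fin 5 → F) := fun x => R ((x - a : HalfSpinModule 5 F))
  have hf : Function.Injective f := fun x y hxy =>
    sub_left_injective (Subtype.ext (hRinj hxy))
  rw [← Finset.card_image_of_injective s hf]
  refine card_le_pow_five_of_pure_differences _ ?_ (Finset.mem_image.mpr ⟨a, ha, ?_⟩)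
    (Finset.mem_image_of_mem f hb) ?_ ?_
  · intro x hx
    obtain ⟨x, -, rfl⟩ := Finset.mem_image.mp hx
    have := list_prod_mem_evenOdd reflectCoord (fun j n ψ => spinAction_mem_evenOdd _ n) (x - a).2
      l.reverse
    rwa [List.length_reverse, ZMod.natCast_eq_zero_iff_even.mpr he] at this
  · simp [f]
  · intro h
    have := algebraMapInv_reflectCoord_list l.reverse (List.nodup_reverse.mpr hl) _ h
    rw [List.reverse_reverse] at this
    exact hlne this
  · intro x hx y hy hxy
    obtain ⟨x, hxs, rfl⟩ := Finset.mem_image.mp hx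
    obtain ⟨y, hys, rfl⟩ := Finset.mem_image.mp hy
    have hne : x ≠ y := fun h => hxy (by rw [h])
    have hfxy : f x - f y = R ((x - y : HalfSpinModule 5 F)) := by
      simp only [f, ← map_sub]
      congr 1
      simp
    rw [hfxy, hRpure]
    exact hs hxs hys hne

theorem one_mem_halfSpinModule {n : ℕ} : (1 : ExteriorAlgebra F (Fin n → F)) ∈ HalfSpinModule n F :=
  Submodule.one_le.mp (CliffordAlgebra.one_le_evenOdd_zero _)

/-- Exterior products of two vectors, with a scalar added, as even spinors. -/
noncomputable def scalarAddWedge (a : Fin 5 → F) :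
    (F × (Fin 5 → F)) →ₗ[F] ExteriorAlgebra F (Fin 5 → F) :=
  (Algebra.linearMap F _).coprod ((LinearMap.mulLeft F (ι F a)).comp (ι F))

theorem scalarAddWedge_apply (a : Fin 5 → F) (x : F × (Fin 5 → F)) :
    scalarAddWedge a x = algebraMap F _ x.1 + ι F a * ι F x.2 := rfl

theorem scalarAddWedge_mem (a : Fin 5 → F) (x : F × (Fin 5 → F)) :
    scalarAddWedge a x ∈ HalfSpinModule 5 F :=
  Submodule.add_mem _ (CliffordAlgebra.one_le_evenOdd_zero _ (Submodule.algebraMap_mem _))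
    (CliffordAlgebra.ι_mul_ι_mem_evenOdd_zero _ _ _)

theorem ker_scalarAddWedge {a : Fin 5 → F} (ha : a ≠ 0) :
    LinearMap.ker (scalarAddWedge a) = Submodule.span F {(0, a)} := by
  refine le_antisymm (fun x hx => ?_) ?_
  · rw [LinearMap.mem_ker, scalarAddWedge_apply] at hx
    have h1 : x.1 = 0 := by
      have := congrArg algebraMapInv hx
      rw [map_add, algebraMapInv_ι_mul, add_zero, map_zero] at this
      rwa [← ExteriorAlgebra.algebraMap_leftInverse (R := F) (Fin 5 → F) x.1]
    obtain ⟨f, hf⟩ := Module.Projective.exists_dual_eq_one F ha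
    rw [h1, map_zero, zero_add] at hx
    have h2 := congrArg (contractLeft f) hx
    rw [ExteriorAlgebra.contractLeft_ι_mul, hf, one_smul, map_zero, ← mul_one (ι F x.2),
      ExteriorAlgebra.contractLeft_ι_mul, ExteriorAlgebra.contractLeft_one, mul_zero, sub_zero,
      mul_one, mul_smul_comm, mul_one, ← map_smul, ← map_sub, ExteriorAlgebra.ι_eq_zero_iff,
      sub_eq_zero] at h2
    rw [Submodule.mem_span_singleton]
    exact ⟨f x.2, Prod.ext (by simp [h1]) (by simp [h2.symm])⟩
  · rw [Submodule.span_singleton_le_iff_mem, LinearMap.mem_ker, scalarAddWedge_apply, map_zero,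
      zero_add, ExteriorAlgebra.ι_sq_zero]

/-- Each functional on the half-spin module vanishes at a pure spinor in the orbit of `1`. -/
theorem exists_purity_preserving (φ : Module.Dual F (HalfSpinModule 5 F)) :
    ∃ (G : Module.End F (ExteriorAlgebra F (Fin 5 → F)))
      (hG : ∀ ψ ∈ HalfSpinModule 5 F, G ψ ∈ HalfSpinModule 5 F),
      (∀ ψ, IsPureSpinor (G ψ) ↔ IsPureSpinor ψ) ∧ (∀ ψ, G ψ = 0 → ψ = 0) ∧
      φ ⟨G 1, hG 1 one_mem_halfSpinModule⟩ = 0 := by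
  set e₀ : Fin 5 → F := Pi.single 0 1
  set e₁ : Fin 5 → F := Pi.single 1 1
  have hone : (1 : ExteriorAlgebra F (Fin 5 → F)) ∈ HalfSpinModule 5 F :=
    one_mem_halfSpinModule
  have hwedge : ι F e₀ * ι F e₁ ∈ HalfSpinModule 5 F :=
    CliffordAlgebra.ι_mul_ι_mem_evenOdd_zero _ _ _
  -- Either `φ` vanishes at `e₀ ∧ e₁`, reached from `1` by two reflections, or at `1 + t e₀ ∧ e₁`
  -- for a suitable `t`.
  by_cases h : φ ⟨ι F e₀ * ι F e₁, hwedge⟩ = 0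
  · refine ⟨([0, 1].map reflectCoord).prod, fun ψ hψ => ?_, isPureSpinor_reflectCoord_list_iff _,
      fun ψ hψ => reflectCoord_list_injective _ (by rw [hψ, map_zero]), ?_⟩
    · have := list_prod_mem_evenOdd reflectCoord (fun j n ψ => spinAction_mem_evenOdd _ n) hψ [0, 1]
      rwa [ZMod.natCast_eq_zero_iff_even.mpr (by simp)] at this
    · rw [← h]
      congr 1
      refine Subtype.ext ?_
      simp only [List.map_cons, List.map_nil, List.prod_cons, List.prod_nil, mul_one,
        Module.End.mul_apply, reflectCoord_apply, contractCoord_apply,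
        ExteriorAlgebra.contractLeft_one, add_zero]
      rw [← mul_one (ι F (Pi.single 1 1 : Fin 5 → F)), ExteriorAlgebra.contractLeft_ι_mul,
        ExteriorAlgebra.contractLeft_one]
      simp [e₀]
  · set t : F := -φ ⟨1, hone⟩ / φ ⟨ι F e₀ * ι F e₁, hwedge⟩ with ht
    have hmem : oneAddWedge t e₀ e₁ ∈ HalfSpinModule 5 F :=
      Submodule.add_mem _ hone (Submodule.smul_mem _ _ hwedge)
    refine ⟨LinearMap.mulLeft F (oneAddWedge t e₀ e₁), fun ψ hψ => ?_,
      isPureSpinor_oneAddWedge_mul_iff _ _ _, fun ψ hψ => ?_, ?_⟩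
    · have := CliffordAlgebra.evenOdd_mul_le (0 : QuadraticForm F (Fin 5 → F)) 0 0
        (Submodule.mul_mem_mul hmem hψ)
      rwa [add_zero] at this
    · rw [LinearMap.mulLeft_apply] at hψ
      rw [← one_mul ψ, ← oneAddWedge_neg_mul t e₀ e₁, mul_assoc, hψ, mul_zero]
    · have hsum : ∀ (h1 : LinearMap.mulLeft F (oneAddWedge t e₀ e₁) 1 ∈ HalfSpinModule 5 F),
          (⟨LinearMap.mulLeft F (oneAddWedge t e₀ e₁) 1, h1⟩ : HalfSpinModule 5 F) =
          ⟨1, hone⟩ + t • ⟨ι F e₀ * ι F e₁, hwedge⟩ :=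
        fun h1 => Subtype.ext (mul_one _)
      have hφ : φ (⟨1, hone⟩ + t • ⟨ι F e₀ * ι F e₁, hwedge⟩) = 0 := by
        rw [map_add, map_smul, smul_eq_mul, ht, div_mul_cancel₀ _ h, add_neg_cancel]
      exact (congrArg φ (hsum _)).trans hφ

theorem separatingGraph_affineHalfSpinGraph (F : Type*) [Field F] [Finite F] :
    SeparatingGraph (affineHalfSpinGraph F) := by
  have hfd : Module.Finite F (ExteriorAlgebra F (Fin 5 → F)) :=
    Module.Finite.of_basis (Pi.basisFun F (Fin 5)).ExteriorAlgebra
  have : Module.Finite F (HalfSpinModule 5 F) := FiniteDimensional.finiteDimensional_submodule _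
  have : Finite (HalfSpinModule 5 F) := Module.finite_of_finite F
  have : Nontrivial (HalfSpinModule 5 F) :=
    ⟨⟨1, one_mem_halfSpinModule⟩, 0, fun h =>
      one_ne_zero (congrArg Subtype.val h)⟩
  refine separatingGraph_of_clique_subspaces (F := F) (affineHalfSpinGraph F) (Equiv.refl _)
    {ψ | IsPureSpinor (ψ : ExteriorAlgebra F (Fin 5 → F))} (fun u v => Iff.rfl) (Nat.card F ^ 5)
    (Nat.one_lt_pow (by norm_num) Finite.one_lt_card)
    card_le_pow_five_of_isClique_affineHalfSpinGraph fun φ _ => ?_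
  obtain ⟨G, hG, hpure, hinj, hφ⟩ := exists_purity_preserving φ
  let H : (Fin 5 → F) → (F × (Fin 5 → F)) →ₗ[F] HalfSpinModule 5 F := fun a =>
    (G.comp (scalarAddWedge a)).codRestrict _ fun x => hG _ (scalarAddWedge_mem a x)
  have hH : ∀ a x, (H a x : ExteriorAlgebra F (Fin 5 → F)) = G (scalarAddWedge a x) :=
    fun _ _ => rfl
  -- As `φ` vanishes at `G 1`, it vanishes on `G (F + a ∧ W)` as soon as `a` lies in the radical of
  -- this alternating form. That space has dimension `6 - 1`.
  let b : (Fin 5 → F) →ₗ[F] (Fin 5 → F) →ₗ[F] F :=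
    LinearMap.mk₂ F (fun a w => φ (H a (0, w)))
      (fun a a' w => by
        rw [← map_add]; congr 1
        refine Subtype.ext ?_
        rw [Submodule.coe_add, hH, hH, hH, ← map_add]
        simp [scalarAddWedge_apply, add_mul])
      (fun c a w => by
        rw [← map_smul]; congr 1
        refine Subtype.ext ?_
        rw [Submodule.coe_smul, hH, hH, ← map_smul]
        simp [scalarAddWedge_apply])
      (fun a w w' => by
        rw [← map_add, ← map_add]; simp)
      (fun c a w => by
        rw [← map_smul, ← map_smul]; simp)
  obtain ⟨a, ha, hb⟩ := exists_ne_zero_of_alternating_five b (fun a => by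
    have : H a (0, a) = 0 := Subtype.ext (by
      rw [hH, scalarAddWedge_apply, map_zero, zero_add, ExteriorAlgebra.ι_sq_zero, map_zero]; rfl)
    exact (congrArg φ this).trans (map_zero φ))
  have hker : LinearMap.ker (H a) = Submodule.span F {(0, a)} := by
    rw [← ker_scalarAddWedge ha]
    ext x
    rw [LinearMap.mem_ker, LinearMap.mem_ker, ← Submodule.coe_eq_zero, hH]
    exact ⟨hinj _, fun h => by rw [h, map_zero]⟩
  refine ⟨LinearMap.range (H a), ?_, ?_, ?_⟩
  · rw [Module.natCard_eq_pow_finrank (K := F)]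
    have := LinearMap.finrank_range_add_finrank_ker (H a)
    rw [hker, finrank_span_singleton (fun h => ha (congrArg Prod.snd h)), Module.finrank_prod,
      Module.finrank_self, Module.finrank_fin_fun] at this
    rw [show Module.finrank F (LinearMap.range (H a)) = 5 by omega]
  · rintro _ ⟨x, rfl⟩ hx
    rw [Set.mem_ofPred_eq, hH, hpure]
    refine isPureSpinor_add_wedge x.1 a x.2 fun h0 => hx (Subtype.ext ?_)
    rw [hH, scalarAddWedge_apply, h0, map_zero]
    rfl
  · rintro _ ⟨x, rfl⟩
    have h1 : H a (1, 0) = ⟨G 1, hG 1 one_mem_halfSpinModule⟩ := Subtype.ext (by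
      rw [hH, scalarAddWedge_apply]; simp)
    have h2 : x = x.1 • (1, 0) + (0, x.2) := by ext <;> simp
    rw [h2, map_add, map_smul, map_add, map_smul, h1, hφ, smul_zero, zero_add]
    exact hb x.2

end AffineHalfSpin

theorem theorem3 (F : Type*) [Field F] [Finite F] :
    SeparatingGraph (altFormsGraph 5 F) ∧
    SeparatingGraph (affineHalfSpinGraph F) ∧
    ∀ e : ℕ, Nat.card F = 2 ^ (2 * e + 1) → SeparatingGraph (suzukiGraph e F) :=
  ⟨separatingGraph_altFormsGraph F, separatingGraph_affineHalfSpinGraph F,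
    separatingGraph_suzukiGraph F⟩
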